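/- Let $V$ be a finite-dimensional complex vector space and $G\le GL(V)$ a non-trivial finite group that acts irreducibly on $V$ and is generated by the set $\mathcal S=\{s\in G:\dim(1-s)V=1\}$ of its complex reflections. For every $s\in\mathcal S$ choose $\alpha_s\in V^*$, $\check\alpha_s\in V$ with $s(v)=v-\langle\alpha_s,v\rangle\check\alpha_s$ for all $v\in V$. Let $\mathbb C(\mathcal S)^G$ be the space of functions $c:\mathcal S\to\mathbb C$, $s\mapsto c_s$, with $c_{gsg^{-1}}=c_s$ for all $g\in G$. For $t\in\mathbb C$ and $c\in\mathbb C(\mathcal S)^G$, the rational Cherednik algebra $H_{t,c}(G)$ is the algebra generated by $V$, $\mathbb CG$ and $V^*$ with relations (besides those of $\mathbb CG$) $[v,v']=0$, $[f,f']=0$, $gv=g(v)g$, $gf=g(f)g$ and $[f,v]=t\langle f,v\rangle\cdot 1+\sum_{s\in\mathcal S}c_s\langle f,(1-s)v\rangle\, s$, for $v,v'\in V$, $f,f'\in V^*$, $g\in G$. Let $Y_G$ be the vector space with basis $\{[s]:s\in\mathcal S\}$, with $G$-action $g([s])=\lambda(g,s)[gsg^{-1}]$, where $g(\check\alpha_s)=\lambda(g,s)\check\alpha_{gsg^{-1}}$,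 and braiding $\Psi([r]\otimes[s])=r([s])\otimes[r]$. Let $Y_G^*$ be the dual $G$-module, with dual basis $[s]^*$ and with the adjoint braiding $\Psi^*$ (with respect to $\langle f\otimes g,v\otimes w\rangle=\langle f,v\rangle\langle g,w\rangle$). For $t'\in\mathbb C$, the deformed quadratic braided double $\mathcal H_{t'}(Y_G)$ is the algebra generated by $Y_G$, $\mathbb CG$ and $Y_G^*$ with relations (besides those of $\mathbb CG$) $\ker(\mathrm{id}+\Psi)\cap\wedge^2Y_G$, $\ker(\mathrm{id}+\Psi^*)\cap\wedge^2Y_G^*$, $g\cdot[s]=g([s])\cdot g$, $g\cdot[s]^*=g([s]^*)\cdot g$, and $[r]^*[s]-[s][r]^*$ equal to $s+t'\cdot 1$ if $r=s$ and to $0$ if $r\ne s$. Here $\wedge^2$ denotes the skew-symmetric tensors in the tensor square. Let $M_c: V\oplus\mathbb CG\oplus V^*\to Y_G\oplus\mathbb CG\oplus Y_G^*$ be the linear map $$M_c(v)=\sum_{s\in\mathcal S}c_s\langle\alpha_s,v\rangle[s],\qquad M_c(g)=g,\qquad M_c(f)=\sum_{s\in\mathcal S}\langle f,\check\alpha_s\rangle[s]^*.$$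 Then there is a non-zero linear functional $\kappa$ on $\mathbb C(\mathcal S)^G$ with $\sum_{s\in\mathcal S}c_s(1-s)v=\kappa(c)v$ for all $c\in\mathbb C(\mathcal S)^G$ and $v\in V$, and for every $t\ne0$ and every $c\in\mathbb C(\mathcal S)^G$ that is generic in the sense that $\kappa(c)\neq0$ (that is, $c$ lies outside the hyperplane $\ker\kappa$) there is $t'\in\mathbb C$, depending on $t$ and $c$, such that $M_c$ extends to an injective algebra homomorphism $H_{t,c}(G)\to\mathcal H_{t'}(Y_G)$. -/

import Mathlib

open scoped TensorProduct

noncomputable section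

namespace CherednikEmbedding

/-! ## Quadratic doubles over a group

`T²` of a module is written as `M ⊗[ℂ] M`. -/

section Double

variable {G : Type*} [Group G] {V : Type*} [AddCommGroup V] [Module ℂ V]

/-- The space of generators `V ⊕ ℂG ⊕ V*`. -/
abbrev Gens (G V : Type*) [Group G] [AddCommGroup V] [Module ℂ V] : Type _ :=
  V × MonoidAlgebra ℂ G × Module.Dual ℂ V

/-- A generator from `V`, in the tensor algebra of the space of generators. -/
def genV (G : Type*) [Group G] {V : Type*} [AddCommGroup V] [Module ℂ V] :
    V →ₗ[ℂ] TensorAlgebra ℂ (Gens G V) :=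
  TensorAlgebra.ι ℂ ∘ₗ LinearMap.inl ℂ V (MonoidAlgebra ℂ G × Module.Dual ℂ V)

/-- A generator from the group algebra. -/
def genG (V : Type*) [AddCommGroup V] [Module ℂ V] {G : Type*} [Group G] :
    MonoidAlgebra ℂ G →ₗ[ℂ] TensorAlgebra ℂ (Gens G V) :=
  TensorAlgebra.ι ℂ ∘ₗ LinearMap.inr ℂ V (MonoidAlgebra ℂ G × Module.Dual ℂ V) ∘ₗ
    LinearMap.inl ℂ (MonoidAlgebra ℂ G) (Module.Dual ℂ V)

/-- A generator from `V*`. -/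
def genD (G : Type*) [Group G] {V : Type*} [AddCommGroup V] [Module ℂ V] :
    Module.Dual ℂ V →ₗ[ℂ] TensorAlgebra ℂ (Gens G V) :=
  TensorAlgebra.ι ℂ ∘ₗ LinearMap.inr ℂ V (MonoidAlgebra ℂ G × Module.Dual ℂ V) ∘ₗ
    LinearMap.inr ℂ (MonoidAlgebra ℂ G) (Module.Dual ℂ V)

/-- For a linear map `j : M → A` into an algebra, the linear map `M ⊗ M → A`,
`m ⊗ m' ↦ j m * j m'`. -/
def quad {M A : Type*} [AddCommGroup M] [Module ℂ M] [Ring A] [Algebra ℂ A]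
    (j : M →ₗ[ℂ] A) : M ⊗[ℂ] M →ₗ[ℂ] A :=
  TensorProduct.lift ((LinearMap.mul ℂ A).compl₁₂ j j)

/-- The defining relations of the double with action `ρ`, commutator pairing `β` and spaces of
quadratic relations `Rm` and `Rp`. The group acts on `V*` contragrediently. -/
inductive DoubleRel (ρ : Representation ℂ G V)
    (β : Module.Dual ℂ V →ₗ[ℂ] V →ₗ[ℂ] MonoidAlgebra ℂ G)
    (Rm : Submodule ℂ (V ⊗[ℂ] V)) (Rp : Submodule ℂ (Module.Dual ℂ V ⊗[ℂ] Module.Dual ℂ V)) :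
    TensorAlgebra ℂ (Gens G V) → TensorAlgebra ℂ (Gens G V) → Prop
  | one : DoubleRel ρ β Rm Rp (genG V 1) 1
  | mul (a b : MonoidAlgebra ℂ G) : DoubleRel ρ β Rm Rp (genG V (a * b)) (genG V a * genG V b)
  | actV (g : G) (v : V) : DoubleRel ρ β Rm Rp
      (genG V (MonoidAlgebra.of ℂ G g) * genV G v)
      (genV G (ρ g v) * genG V (MonoidAlgebra.of ℂ G g))
  | actD (g : G) (f : Module.Dual ℂ V) : DoubleRel ρ β Rm Rp
      (genG V (MonoidAlgebra.of ℂ G g) * genD G f)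
      (genD G (ρ.dual g f) * genG V (MonoidAlgebra.of ℂ G g))
  | comm (f : Module.Dual ℂ V) (v : V) : DoubleRel ρ β Rm Rp
      (genD G f * genV G v - genV G v * genD G f) (genG V (β f v))
  | quadV (x : V ⊗[ℂ] V) (hx : x ∈ Rm) : DoubleRel ρ β Rm Rp (quad (genV G) x) 0
  | quadD (x : Module.Dual ℂ V ⊗[ℂ] Module.Dual ℂ V) (hx : x ∈ Rp) :
      DoubleRel ρ β Rm Rp (quad (genD G) x) 0

/-- The algebra generated by `V`, `ℂG` and `V*` subject to the relations `DoubleRel`. -/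
abbrev Double (ρ : Representation ℂ G V)
    (β : Module.Dual ℂ V →ₗ[ℂ] V →ₗ[ℂ] MonoidAlgebra ℂ G)
    (Rm : Submodule ℂ (V ⊗[ℂ] V))
    (Rp : Submodule ℂ (Module.Dual ℂ V ⊗[ℂ] Module.Dual ℂ V)) : Type _ :=
  RingQuot (DoubleRel ρ β Rm Rp)

/-- The canonical map from the space of generators to the double. -/
def Double.ι (ρ : Representation ℂ G V)
    (β : Module.Dual ℂ V →ₗ[ℂ] V →ₗ[ℂ] MonoidAlgebra ℂ G)
    (Rm : Submodule ℂ (V ⊗[ℂ] V))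
    (Rp : Submodule ℂ (Module.Dual ℂ V ⊗[ℂ] Module.Dual ℂ V)) :
    Gens G V →ₗ[ℂ] Double ρ β Rm Rp :=
  (RingQuot.mkAlgHom ℂ (DoubleRel ρ β Rm Rp)).toLinearMap ∘ₗ TensorAlgebra.ι ℂ

/-- Skew-symmetric tensors `∧²M ⊆ M ⊗ M`: the kernel of `id + τ`, with `τ` the flip. -/
def wedge (M : Type*) [AddCommGroup M] [Module ℂ M] : Submodule ℂ (M ⊗[ℂ] M) :=
  LinearMap.ker (LinearMap.id + (TensorProduct.comm ℂ M M).toLinearMap)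

end Double

/-! ## Complex reflections and roots -/

section Reflections

variable {V : Type*} [AddCommGroup V] [Module ℂ V]

/-- A complex reflection: an invertible `g` with `dim (1 - g)V = 1`. -/
def IsComplexReflection (g : V ≃ₗ[ℂ] V) : Prop :=
  Module.finrank ℂ (LinearMap.range (LinearMap.id - (g : V →ₗ[ℂ] V))) = 1

variable (G : Subgroup (V ≃ₗ[ℂ] V))

/-- The tautological representation of a linear group `G ≤ GL(V)`. -/
def natRep : Representation ℂ G V :=
  (LinearEquiv.automorphismGroup.toLinearMapMonoidHom (R := ℂ) (M := V)).comp G.subtype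

/-- The set `S` of complex reflections in `G`. -/
abbrev Refl : Type _ := {s : G // IsComplexReflection (s : V ≃ₗ[ℂ] V)}

instance [Finite G] : Fintype (Refl G) := Fintype.ofFinite _

variable {G}

theorem isComplexReflection_conj (g s : V ≃ₗ[ℂ] V) (hs : IsComplexReflection s) :
    IsComplexReflection (g * s * g⁻¹) := by
  unfold IsComplexReflection at *
  have h : LinearMap.range (LinearMap.id - ((g * s * g⁻¹ : V ≃ₗ[ℂ] V) : V →ₗ[ℂ] V)) =
      (LinearMap.range (LinearMap.id - (s : V →ₗ[ℂ] V))).map (g : V →ₗ[ℂ] V) := by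
    ext x
    simp only [LinearMap.mem_range, Submodule.mem_map]
    constructor
    · rintro ⟨y, rfl⟩
      refine ⟨_, ⟨g⁻¹ y, rfl⟩, ?_⟩
      simp
    · rintro ⟨_, ⟨y, rfl⟩, rfl⟩
      refine ⟨g y, ?_⟩
      have : g⁻¹ (g y) = y := g.symm_apply_apply y
      simp [this]
  rw [h, LinearEquiv.finrank_map_eq]
  exact hs

/-- Conjugation `s ↦ g s g⁻¹` on the set of complex reflections. -/
def Refl.conj (g : G) (s : Refl G) : Refl G :=
  ⟨g * s.1 * g⁻¹, by
    rw [Subgroup.coe_mul, Subgroup.coe_mul, Subgroup.coe_inv]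
    exact isComplexReflection_conj _ _ s.2⟩

variable (G)

/-- The space `ℂ(S)^G` of conjugation-invariant functions on the set of complex reflections. -/
def ClassFun : Submodule ℂ (Refl G → ℂ) where
  carrier := {c | ∀ g s, c (Refl.conj g s) = c s}
  add_mem' := by
    intro a b ha hb g s
    simp [ha g s, hb g s]
  zero_mem' := by
    intro g s
    rfl
  smul_mem' := by
    intro k a ha g s
    simp [ha g s]

/-- A choice of roots `α_s ∈ V*` and coroots `α̌_s ∈ V` of all complex reflections of `G`:
`s(v) = v - ⟨α_s, v⟩ α̌_s`. -/
structure Roots where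
  root : Refl G → Module.Dual ℂ V
  coroot : Refl G → V
  apply_eq : ∀ s v, (s.1 : V ≃ₗ[ℂ] V) v = v - root s v • coroot s

theorem Roots.nonempty : Nonempty (Roots G) := by
  have key : ∀ s : Refl G, ∃ p : Module.Dual ℂ V × V,
      ∀ v, (s.1 : V ≃ₗ[ℂ] V) v = v - p.1 v • p.2 := by
    intro s
    obtain ⟨b, -, hb⟩ := finrank_eq_one_iff'.mp s.2
    let T : V →ₗ[ℂ] V := LinearMap.id - ((s.1 : V ≃ₗ[ℂ] V) : V →ₗ[ℂ] V)
    have hspan : ∀ v, ∃ k : ℂ, k • (b : V) = T v := fun v => by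
      obtain ⟨k, hk⟩ := hb ⟨T v, ⟨v, rfl⟩⟩
      exact ⟨k, congrArg Subtype.val hk⟩
    have hb0 : (b : V) ≠ 0 := by
      intro h0
      have h1 := s.2
      unfold IsComplexReflection at h1
      have : LinearMap.range T = ⊥ := by
        rw [LinearMap.range_eq_bot]
        ext v
        obtain ⟨k, hk⟩ := hspan v
        rw [← hk, h0]
        simp
      change Module.finrank ℂ (LinearMap.range T) = 1 at h1
      rw [this] at h1
      simp at h1
    obtain ⟨f, hf⟩ := Module.Projective.exists_dual_eq_one ℂ hb0
    refine ⟨(f ∘ₗ T, b), fun v => ?_⟩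
    obtain ⟨k, hk⟩ := hspan v
    have h2 : f (T v) = k := by
      rw [← hk]
      simp [hf]
    change _ = v - (f (T v)) • (b : V)
    rw [h2, hk]
    simp [T]
  choose p hp using key
  exact ⟨⟨fun s => (p s).1, fun s => (p s).2, hp⟩⟩

end Reflections

/-! ## The Yetter–Drinfeld module of a linear group -/

section YetterDrinfeld

variable {V : Type*} [AddCommGroup V] [Module ℂ V] {G : Subgroup (V ≃ₗ[ℂ] V)} (R : Roots G)

theorem Roots.exists_root_eq_one (s : Refl G) : ∃ v, R.root s v = 1 := by
  have h : R.root s ≠ 0 := by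
    intro h0
    have h1 := s.2
    unfold IsComplexReflection at h1
    have : LinearMap.id - ((s.1 : V ≃ₗ[ℂ] V) : V →ₗ[ℂ] V) = 0 := by
      ext v
      simp [R.apply_eq s v, h0]
    rw [this, LinearMap.range_zero, finrank_bot] at h1
    exact zero_ne_one h1
  obtain ⟨w, hw⟩ : ∃ w, R.root s w ≠ 0 := by
    by_contra! hc
    exact h (LinearMap.ext hc)
  exact ⟨(R.root s w)⁻¹ • w, by simp [hw]⟩

theorem Roots.coroot_ne_zero (s : Refl G) : R.coroot s ≠ 0 := by
  intro h0
  have h1 := s.2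
  unfold IsComplexReflection at h1
  have : LinearMap.id - ((s.1 : V ≃ₗ[ℂ] V) : V →ₗ[ℂ] V) = 0 := by
    ext v
    simp [R.apply_eq s v, h0]
  rw [this, LinearMap.range_zero, finrank_bot] at h1
  exact zero_ne_one h1

theorem Roots.exists_lam (g : G) (s : Refl G) :
    ∃ l : ℂ, (g : V ≃ₗ[ℂ] V) (R.coroot s) = l • R.coroot (Refl.conj g s) := by
  obtain ⟨v, hv⟩ := R.exists_root_eq_one s
  refine ⟨R.root (Refl.conj g s) ((g : V ≃ₗ[ℂ] V) v), ?_⟩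
  have h1 := R.apply_eq s v
  have h2 := R.apply_eq (Refl.conj g s) ((g : V ≃ₗ[ℂ] V) v)
  have h3 : ((Refl.conj g s).1 : V ≃ₗ[ℂ] V) ((g : V ≃ₗ[ℂ] V) v) =
      (g : V ≃ₗ[ℂ] V) ((s.1 : V ≃ₗ[ℂ] V) v) := by
    have : (g : V ≃ₗ[ℂ] V)⁻¹ ((g : V ≃ₗ[ℂ] V) v) = v :=
      (g : V ≃ₗ[ℂ] V).symm_apply_apply v
    simp [Refl.conj, LinearEquiv.mul_apply, this]
  rw [h3, h1, hv, one_smul, map_sub] at h2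
  exact sub_right_injective h2

/-- The scalar `λ(g, s)` with `g(α̌_s) = λ(g, s) α̌_{gsg⁻¹}`. -/
def Roots.lam (g : G) (s : Refl G) : ℂ := (R.exists_lam g s).choose

theorem Roots.lam_spec (g : G) (s : Refl G) :
    (g : V ≃ₗ[ℂ] V) (R.coroot s) = R.lam g s • R.coroot (Refl.conj g s) :=
  (R.exists_lam g s).choose_spec

variable (G) in
/-- The space `Y_G` with basis the symbols `[s]`, `s ∈ S`. -/
abbrev Y : Type _ := Refl G →₀ ℂ

/-- The basis vector `[s]` of `Y_G`. -/
def br (s : Refl G) : Y G := Finsupp.single s 1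

variable (G) in
/-- The vector `[s]*` of the dual basis of `Y_G*`. -/
def brDual (s : Refl G) : Module.Dual ℂ (Y G) := Finsupp.lapply s

/-- The `G`-action on `Y_G`: `g([s]) = λ(g, s)[gsg⁻¹]`. -/
def Roots.rep : Representation ℂ G (Y G) where
  toFun g := Finsupp.linearCombination ℂ fun s => R.lam g s • br (Refl.conj g s)
  map_one' := by
    ext s : 2
    have hc : Refl.conj (1 : G) s = s := Subtype.ext (by simp [Refl.conj])
    have h := R.lam_spec 1 s
    have hl : R.lam 1 s = 1 := by
      rw [hc] at h
      have h' : ((1 : ℂ) - R.lam 1 s) • R.coroot s = 0 := by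
        rw [sub_smul, ← h]
        simp
      rcases smul_eq_zero.mp h' with h' | h'
      · exact (sub_eq_zero.mp h').symm
      · exact absurd h' (R.coroot_ne_zero s)
    simp [hc, hl, br]
  map_mul' g h := by
    ext s : 2
    have hc : Refl.conj (g * h) s = Refl.conj g (Refl.conj h s) :=
      Subtype.ext (by simp [Refl.conj, mul_assoc])
    have e := R.lam_spec (g * h) s
    have hl : R.lam (g * h) s = R.lam h s * R.lam g (Refl.conj h s) := by
      have e' : ((g * h : G) : V ≃ₗ[ℂ] V) (R.coroot s) =
          (R.lam h s * R.lam g (Refl.conj h s)) • R.coroot (Refl.conj g (Refl.conj h s)) := by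
        rw [Subgroup.coe_mul, LinearEquiv.mul_apply, R.lam_spec h s, map_smul, R.lam_spec g,
          smul_smul]
      rw [e', hc] at e
      have h' := sub_eq_zero.mpr e
      rw [← sub_smul] at h'
      rcases smul_eq_zero.mp h' with h' | h'
      · exact (sub_eq_zero.mp h').symm
      · exact absurd h' (R.coroot_ne_zero _)
    simp [hc, hl, br]

/-- The braiding `Ψ([r] ⊗ [s]) = r([s]) ⊗ [r]` on `Y_G`. -/
def Roots.braiding : Y G ⊗[ℂ] Y G →ₗ[ℂ] Y G ⊗[ℂ] Y G :=
  TensorProduct.lift <| Finsupp.linearCombination ℂ fun r : Refl G =>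
    ((TensorProduct.mk ℂ (Y G) (Y G)).flip (br r)) ∘ₗ R.rep r.1

/-- The quadratic relations `ker(id + Ψ) ∩ ∧²Y_G`. -/
def Roots.quadRel : Submodule ℂ (Y G ⊗[ℂ] Y G) :=
  LinearMap.ker (LinearMap.id + R.braiding) ⊓ wedge (Y G)

/-- The quadratic relations `ker(id + Ψ*) ∩ ∧²Y_G*`. Here `Ψ*` is the adjoint of `Ψ` with respect
to `⟨f ⊗ g, v ⊗ w⟩ = ⟨f, v⟩⟨g, w⟩`, so `x` is in the kernel of `id + Ψ*` if and only if it
pairs to zero with `u + Ψ(u)` for all `u`. -/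
def Roots.quadRelDual : Submodule ℂ (Module.Dual ℂ (Y G) ⊗[ℂ] Module.Dual ℂ (Y G)) :=
  LinearMap.ker ((LinearMap.id + R.braiding).dualMap ∘ₗ TensorProduct.dualDistrib ℂ (Y G) (Y G)) ⊓
    wedge (Module.Dual ℂ (Y G))

variable (G) [Finite G]

/-- The bilinear pairing `Y_G* × Y_G → ℂG` with `([s]*, [s]) ↦ s + t` and
`([r]*, [s]) ↦ 0` for `r ≠ s`. -/
def pairingY (t : ℂ) : Module.Dual ℂ (Y G) →ₗ[ℂ] Y G →ₗ[ℂ] MonoidAlgebra ℂ G :=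
  ∑ s : Refl G, LinearMap.mk₂ ℂ
    (fun f y => (f (br s) * brDual G s y) • (MonoidAlgebra.of ℂ G s.1 + t • 1))
    (by intros; simp only [LinearMap.add_apply, add_mul, add_smul])
    (by intros; simp only [LinearMap.smul_apply, smul_eq_mul, smul_smul, mul_assoc])
    (by intros; simp only [map_add, mul_add, add_smul])
    (by intros; simp only [map_smul, smul_eq_mul, smul_smul]; congr 1; ring)

variable {G}

/-- The deformed quadratic braided double `H_t(Y_G)`. -/
abbrev Roots.DeformedDouble (t : ℂ) : Type _ :=
  Double R.rep (pairingY G t) R.quadRel R.quadRelDual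

/-- The canonical map `Y_G ⊕ ℂG ⊕ Y_G* → H_t(Y_G)`. -/
def Roots.deformedι (t : ℂ) : Gens G (Y G) →ₗ[ℂ] R.DeformedDouble t :=
  Double.ι R.rep (pairingY G t) R.quadRel R.quadRelDual

/-- The linear map `M_c : V ⊕ ℂG ⊕ V* → Y_G ⊕ ℂG ⊕ Y_G*`. -/
def Roots.M (c : Refl G → ℂ) : Gens G V →ₗ[ℂ] Gens G (Y G) :=
  LinearMap.prodMap (∑ s : Refl G, c s • (R.root s).smulRight (br s))
    (LinearMap.prodMap LinearMap.id
      (∑ s : Refl G, (Module.Dual.eval ℂ V (R.coroot s)).smulRight (brDual G s)))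

end YetterDrinfeld

/-! ## Rational Cherednik algebras -/

section Cherednik

variable {V : Type*} [AddCommGroup V] [Module ℂ V] (G : Subgroup (V ≃ₗ[ℂ] V)) [Finite G]

/-- The pairing `(f, v) ↦ t⟨f, v⟩ · 1 + ∑_s c_s ⟨f, (1 - s)v⟩ · s`. -/
def pairingV (t : ℂ) (c : Refl G → ℂ) : Module.Dual ℂ V →ₗ[ℂ] V →ₗ[ℂ] MonoidAlgebra ℂ G :=
  LinearMap.mk₂ ℂ (fun f v => (t * f v) • (1 : MonoidAlgebra ℂ G))
    (by intros; simp [mul_add, add_smul])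
    (by intros; simp only [LinearMap.smul_apply, smul_eq_mul, smul_smul]; congr 1; ring)
    (by intros; simp [mul_add, add_smul])
    (by intros; simp only [map_smul, smul_eq_mul, smul_smul]; congr 1; ring) +
  ∑ s : Refl G, LinearMap.mk₂ ℂ
    (fun f v => (c s * f (v - (s.1 : V ≃ₗ[ℂ] V) v)) • MonoidAlgebra.of ℂ G s.1)
    (by intros; simp only [LinearMap.add_apply, mul_add, add_smul])
    (by intros; simp only [LinearMap.smul_apply, smul_eq_mul, smul_smul]; congr 1; ring)
    (by intros; simp only [map_add, map_sub, ← add_smul]; congr 1; ring)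
    (by intros; simp only [map_smul, map_sub, smul_eq_mul, smul_smul]; congr 1; ring)

/-- The rational Cherednik algebra `H_{t,c}(G)`: the quadratic relations `∧²V`, `∧²V*` say that
elements of `V` commute and elements of `V*` commute. -/
abbrev Cherednik (t : ℂ) (c : Refl G → ℂ) : Type _ :=
  Double (natRep G) (pairingV G t c) (wedge V) (wedge (Module.Dual ℂ V))

/-- The canonical map `V ⊕ ℂG ⊕ V* → H_{t,c}(G)`. -/
def cherednikι (t : ℂ) (c : Refl G → ℂ) : Gens G V →ₗ[ℂ] Cherednik G t c :=
  Double.ι (natRep G) (pairingV G t c) (wedge V) (wedge (Module.Dual ℂ V))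

end Cherednik

end CherednikEmbedding

end

/-!
Both algebras are doubles: the relations of `H_{t,c}(G)` and `𝓗_{t'}(Y_G)` differ only in the
representation, the spaces of quadratic relations and the pairing with values in `ℂG`. A double has
a triangular decomposition, i.e. multiplication `T(V)/(Rm) ⊗ T(V*)/(Rp) ⊗ ℂG → Double` is bijective,
as soon as the data are `G`-equivariant and commuting a generator past a quadratic relation of the
other half gives zero. Surjectivity is reordering; injectivity follows from the action on a
Verma module `T(V)/(Rm) ⊗ W`, on which a functional `f` acts by an operator of twisted derivation
type. Such an operator exists because left multiplication by `v` deforms, over the dual numbers,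
to `v + ε β(f, v)` without violating the relations `Rm`.

The map `M_c` is the identity on `ℂG` and is given by linear maps `μ : V → Y_G` and
`ν : V* → Y_G*` on the generators, where `ν` is the transpose of `μ₀ : Y_G → V`, `[s] ↦ α̌_s`. It
respects the relations of the two doubles, with `t' = t / κ(c)`, and in terms of the triangular
decompositions it is `T(μ) ⊗ T(ν) ⊗ id`. Since `μ₀ ∘ μ = ∑ c_s (1 - s) = κ(c)` by Schur's lemma,
`κ(c)⁻¹ μ₀` and `κ(c)⁻¹ μᵀ` induce left inverses of `T(μ)` and `T(ν)`: they respect the relations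
because those of `𝓗_{t'}(Y_G)` are skew-symmetric and those of `H_{t,c}(G)` are all skew-symmetric
tensors. Finally `κ ≠ 0`: `1 - ⟨α_s, α̌_s⟩` is a root of unity different from `1`, so
`dim V · κ(1) = ∑ ⟨α_s, α̌_s⟩` has positive real part.
-/

noncomputable section

namespace CherednikEmbedding

set_option maxSynthPendingDepth 3

section General

theorem submodule_eq_top_of_adjoin_eq_top {K A : Type*} [CommSemiring K] [Semiring A] [Algebra K A]
    {s : Set A} (hs : Algebra.adjoin K s = ⊤) {S : Submodule K A} (one_mem : 1 ∈ S)
    (mul_mem : ∀ x ∈ s, ∀ y ∈ S, x * y ∈ S) : S = ⊤ := by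
  have adjoin_mul_mem : ∀ x ∈ Algebra.adjoin K s, ∀ y ∈ S, x * y ∈ S := by
    intro x hx
    induction hx using Algebra.adjoin_induction with
    | mem x hx => exact mul_mem x hx
    | algebraMap r =>
      intro y hy
      rw [← Algebra.smul_def]
      exact S.smul_mem r hy
    | add a b _ _ ha hb =>
      intro y hy
      rw [add_mul]
      exact S.add_mem (ha y hy) (hb y hy)
    | mul a b _ _ ha hb =>
      intro y hy
      rw [mul_assoc]
      exact ha _ (hb y hy)
  refine eq_top_iff.mpr fun x _ => ?_
  simpa only [mul_one] using adjoin_mul_mem x (hs ▸ Algebra.mem_top) 1 one_mem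

theorem adjoin_range_mkAlgHom_comp_ι {K M : Type*} [CommSemiring K] [AddCommMonoid M] [Module K M]
    (r : TensorAlgebra K M → TensorAlgebra K M → Prop) :
    Algebra.adjoin K (Set.range ((RingQuot.mkAlgHom K r).toLinearMap ∘ₗ TensorAlgebra.ι K)) =
      ⊤ := by
  have hrange : Set.range ((RingQuot.mkAlgHom K r).toLinearMap ∘ₗ TensorAlgebra.ι K) =
      RingQuot.mkAlgHom K r '' Set.range (TensorAlgebra.ι K) :=
    Set.range_comp _ (TensorAlgebra.ι K)
  rw [hrange, Algebra.adjoin_image, TensorAlgebra.adjoin_range_ι, Algebra.map_top,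
    AlgHom.range_eq_top]
  exact RingQuot.mkAlgHom_surjective K r

theorem algHom_monoidAlgebra_mul_mem {K G A : Type*} [CommSemiring K] [Monoid G] [Semiring A]
    [Algebra K A] (Γ : MonoidAlgebra K G →ₐ[K] A) {S : Submodule K A} {y : A}
    (hy : ∀ g, Γ (MonoidAlgebra.of K G g) * y ∈ S) (a : MonoidAlgebra K G) : Γ a * y ∈ S := by
  induction a using MonoidAlgebra.induction_on with
  | of g => exact hy g
  | add a b ha hb =>
    rw [map_add, add_mul]
    exact S.add_mem ha hb
  | smul r a ha =>
    rw [map_smul, smul_mul_assoc]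
    exact S.smul_mem r ha

theorem dualDistrib_map_dualMap {K M N : Type*} [CommSemiring K] [AddCommMonoid M] [Module K M]
    [AddCommMonoid N] [Module K N] (φ : M →ₗ[K] N) (p : Module.Dual K N ⊗[K] Module.Dual K N) :
    TensorProduct.dualDistrib K M M (TensorProduct.map φ.dualMap φ.dualMap p) =
      TensorProduct.dualDistrib K N N p ∘ₗ TensorProduct.map φ φ := by
  induction p using TensorProduct.induction_on with
  | zero => simp
  | add p q hp hq => simp only [map_add, hp, hq, LinearMap.add_comp]
  | tmul f f' => exact TensorProduct.ext' fun x y => by simp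

variable {M N A B : Type*} [AddCommGroup M] [Module ℂ M] [AddCommGroup N] [Module ℂ N]
  [Ring A] [Algebra ℂ A] [Ring B] [Algebra ℂ B]

theorem apply_eq_zero_of_mem_wedge (b : M ⊗[ℂ] M →ₗ[ℂ] N)
    (hb : ∀ x y, b (x ⊗ₜ y) = b (y ⊗ₜ x)) {p : M ⊗[ℂ] M} (hp : p ∈ wedge M) : b p = 0 := by
  have hcomm : b ∘ₗ (TensorProduct.comm ℂ M M).toLinearMap = b :=
    TensorProduct.ext' fun x y => by simp [hb x y]
  have hadd : b p + b p = 0 := by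
    conv_lhs => enter [2]; rw [← hcomm]
    rw [LinearMap.comp_apply, ← map_add, show p + _ = 0 from hp, map_zero]
  rw [← two_smul ℂ] at hadd
  exact (smul_eq_zero.mp hadd).resolve_left two_ne_zero

theorem map_mem_wedge (φ : M →ₗ[ℂ] N) {p : M ⊗[ℂ] M} (hp : p ∈ wedge M) :
    TensorProduct.map φ φ p ∈ wedge N := by
  rw [wedge, LinearMap.mem_ker, ← LinearMap.comp_apply]
  exact apply_eq_zero_of_mem_wedge _ (fun x y => by simp [add_comm]) hp

@[simp] theorem quad_tmul (j : M →ₗ[ℂ] A) (x y : M) : quad j (x ⊗ₜ y) = j x * j y := rfl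

theorem map_quad (φ : A →ₐ[ℂ] B) (j : M →ₗ[ℂ] A) (x : M ⊗[ℂ] M) :
    φ (quad j x) = quad (φ.toLinearMap ∘ₗ j) x := by
  have : φ.toLinearMap ∘ₗ quad j = quad (φ.toLinearMap ∘ₗ j) :=
    TensorProduct.ext' fun x y => by simp
  exact LinearMap.congr_fun this x

theorem quad_comp (j : N →ₗ[ℂ] A) (φ : M →ₗ[ℂ] N) (x : M ⊗[ℂ] M) :
    quad (j ∘ₗ φ) x = quad j (TensorProduct.map φ φ x) := by
  have : quad (j ∘ₗ φ) = quad j ∘ₗ TensorProduct.map φ φ :=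
    TensorProduct.ext' fun x y => by simp
  exact LinearMap.congr_fun this x

/-- The polarization `x ⊗ y ↦ j(x) k(y) + k(x) j(y)` of the quadratic expression `quad`, that is,
the part of `quad (j + k)` which is linear in both `j` and `k`. -/
def polar (j k : M →ₗ[ℂ] A) : M ⊗[ℂ] M →ₗ[ℂ] A :=
  TensorProduct.lift ((LinearMap.mul ℂ A).compl₁₂ j k + (LinearMap.mul ℂ A).compl₁₂ k j)

@[simp] theorem polar_tmul (j k : M →ₗ[ℂ] A) (x y : M) :
    polar j k (x ⊗ₜ y) = j x * k y + k x * j y := rfl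

/-- The linear map `j + εk` into the dual numbers over a (not necessarily commutative) algebra. -/
def dualNumberMap (j k : M →ₗ[ℂ] A) : M →ₗ[ℂ] DualNumber A where
  toFun m := TrivSqZeroExt.inl (j m) + TrivSqZeroExt.inr (k m)
  map_add' x y := by ext <;> simp
  map_smul' r x := by ext <;> simp

@[simp] theorem fst_dualNumberMap (j k : M →ₗ[ℂ] A) (m : M) :
    (dualNumberMap j k m).fst = j m := by simp [dualNumberMap]

@[simp] theorem snd_dualNumberMap (j k : M →ₗ[ℂ] A) (m : M) :
    (dualNumberMap j k m).snd = k m := by simp [dualNumberMap]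

theorem quad_dualNumberMap (j k : M →ₗ[ℂ] A) (x : M ⊗[ℂ] M) :
    quad (dualNumberMap j k) x =
      TrivSqZeroExt.inl (quad j x) + TrivSqZeroExt.inr (polar j k x) := by
  have : quad (dualNumberMap j k) = dualNumberMap (quad j) (polar j k) :=
    TensorProduct.ext' fun x y => by ext <;> simp
  rw [this]
  rfl

end General

/-! ## Quadratic algebras -/

section QuadAlg

variable {M M' : Type*} [AddCommGroup M] [Module ℂ M] [AddCommGroup M'] [Module ℂ M']
  {A : Type*} [Ring A] [Algebra ℂ A]

/-- The quadratic algebra `T(M)/(Q)` of a space of quadratic relations `Q ⊆ M ⊗ M`. -/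
def QuadAlg (Q : Submodule ℂ (M ⊗[ℂ] M)) : Type _ :=
  RingQuot fun a b : TensorAlgebra ℂ M => ∃ x ∈ Q, a = quad (TensorAlgebra.ι ℂ) x ∧ b = 0

namespace QuadAlg

variable (Q : Submodule ℂ (M ⊗[ℂ] M)) {Q' : Submodule ℂ (M' ⊗[ℂ] M')}

instance : Ring (QuadAlg Q) := inferInstanceAs (Ring (RingQuot _))

instance : Algebra ℂ (QuadAlg Q) := inferInstanceAs (Algebra ℂ (RingQuot _))

/-- The inclusion of the generators into a quadratic algebra. -/
def ι : M →ₗ[ℂ] QuadAlg Q := (RingQuot.mkAlgHom ℂ _).toLinearMap ∘ₗ TensorAlgebra.ι ℂ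

variable {Q}

theorem quad_ι {x : M ⊗[ℂ] M} (hx : x ∈ Q) : quad (ι Q) x = 0 :=
  (map_quad _ _ x).symm.trans
    ((RingQuot.mkAlgHom_rel ℂ ⟨x, hx, rfl, rfl⟩).trans (map_zero _))

/-- The universal property of a quadratic algebra. -/
def lift (j : M →ₗ[ℂ] A) (hj : ∀ x ∈ Q, quad j x = 0) : QuadAlg Q →ₐ[ℂ] A :=
  RingQuot.liftAlgHom ℂ ⟨TensorAlgebra.lift ℂ j, by
    rintro _ _ ⟨x, hx, rfl, rfl⟩
    rw [map_quad, map_zero, ← hj x hx]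
    congr 1
    exact congrArg quad (TensorAlgebra.ι_comp_lift j)⟩

@[simp] theorem lift_ι (j : M →ₗ[ℂ] A) (hj : ∀ x ∈ Q, quad j x = 0) (m : M) :
    lift j hj (ι Q m) = j m :=
  (RingQuot.liftAlgHom_mkAlgHom_apply _ _ _ _).trans (TensorAlgebra.lift_ι_apply j m)

theorem algHom_ext {φ ψ : QuadAlg Q →ₐ[ℂ] A} (h : ∀ m, φ (ι Q m) = ψ (ι Q m)) : φ = ψ :=
  RingQuot.ringQuot_ext' _ _ _ (TensorAlgebra.hom_ext (LinearMap.ext h))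

theorem submodule_eq_top {S : Submodule ℂ (QuadAlg Q)} (one_mem : 1 ∈ S)
    (ι_mul_mem : ∀ m, ∀ y ∈ S, ι Q m * y ∈ S) : S = ⊤ :=
  submodule_eq_top_of_adjoin_eq_top (adjoin_range_mkAlgHom_comp_ι _) one_mem
    (Set.forall_mem_range.mpr ι_mul_mem)

/-- The functoriality of quadratic algebras. -/
def map (μ : M →ₗ[ℂ] M') (hμ : Q ≤ Q'.comap (TensorProduct.map μ μ)) :
    QuadAlg Q →ₐ[ℂ] QuadAlg Q' :=
  lift (ι Q' ∘ₗ μ) fun x hx => (quad_comp _ _ x).trans (quad_ι (hμ hx))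

@[simp] theorem map_ι (μ : M →ₗ[ℂ] M') (hμ : Q ≤ Q'.comap (TensorProduct.map μ μ)) (m : M) :
    map μ hμ (ι Q m) = ι Q' (μ m) :=
  lift_ι _ _ m

theorem map_injective {μ : M →ₗ[ℂ] M'} (hμ : Q ≤ Q'.comap (TensorProduct.map μ μ))
    {η : M' →ₗ[ℂ] M} (hη : Q' ≤ Q.comap (TensorProduct.map η η)) (hημ : ∀ m, η (μ m) = m) :
    Function.Injective (map μ hμ) := by
  have hcomp : (map η hη).comp (map μ hμ) = AlgHom.id ℂ (QuadAlg Q) :=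
    algHom_ext fun m => by simp [hημ]
  exact Function.LeftInverse.injective (g := map η hη) (AlgHom.congr_fun hcomp)

section DualNumbers

variable (j b : M →ₗ[ℂ] A) (hj : ∀ x ∈ Q, quad j x = 0) (hb : ∀ x ∈ Q, polar j b x = 0)

/-- The first-order deformation of `lift j` in which a generator `m` acts as `j(m) + ε b(m)`. -/
def liftDualNumber : QuadAlg Q →ₐ[ℂ] DualNumber A :=
  lift (dualNumberMap j b) fun x hx => by
    rw [quad_dualNumberMap, hj x hx, hb x hx, TrivSqZeroExt.inl_zero, TrivSqZeroExt.inr_zero,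
      add_zero]

theorem liftDualNumber_ι (m : M) : liftDualNumber j b hj hb (ι Q m) = dualNumberMap j b m :=
  lift_ι _ _ m

theorem fst_liftDualNumber (a : QuadAlg Q) : (liftDualNumber j b hj hb a).fst = lift j hj a := by
  have : (TrivSqZeroExt.fstHom ℂ A A).comp (liftDualNumber j b hj hb) = lift j hj :=
    algHom_ext fun m => by simp [liftDualNumber_ι]
  exact AlgHom.congr_fun this a

end DualNumbers

section TensorModule

variable {W P : Type*} [AddCommGroup W] [Module ℂ W] [AddCommGroup P] [Module ℂ P]

variable (Q W) in
/-- The action of a quadratic algebra on a free module `QuadAlg Q ⊗ W` by left multiplication. -/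
def leftMul : QuadAlg Q →ₐ[ℂ] Module.End ℂ (QuadAlg Q ⊗[ℂ] W) :=
  (Module.End.rTensorAlgHom ℂ (QuadAlg Q) W).comp (Algebra.lmul ℂ (QuadAlg Q))

@[simp] theorem leftMul_tmul (a b : QuadAlg Q) (w : W) :
    leftMul Q W a (b ⊗ₜ w) = (a * b) ⊗ₜ w := rfl

variable (Q W) in
/-- The creation operators: left multiplication by the generators on `QuadAlg Q ⊗ W`. -/
def creation : M →ₗ[ℂ] Module.End ℂ (QuadAlg Q ⊗[ℂ] W) := (leftMul Q W).toLinearMap ∘ₗ ι Q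

@[simp] theorem creation_tmul (m : M) (a : QuadAlg Q) (w : W) :
    creation Q W m (a ⊗ₜ w) = (ι Q m * a) ⊗ₜ w := rfl

theorem map_creation {W' : Type*} [AddCommGroup W'] [Module ℂ W'] {μ : M →ₗ[ℂ] M'}
    (hμ : Q ≤ Q'.comap (TensorProduct.map μ μ)) (k : W →ₗ[ℂ] W') (m : M) (x : QuadAlg Q ⊗[ℂ] W) :
    TensorProduct.map (map μ hμ).toLinearMap k (creation Q W m x) =
      creation Q' W' (μ m) (TensorProduct.map (map μ hμ).toLinearMap k x) := by
  induction x using TensorProduct.induction_on with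
  | zero => simp
  | add x y hx hy => simp only [map_add, hx, hy]
  | tmul a w => simp

variable (Q W) in
theorem quad_creation : ∀ x ∈ Q, quad (creation Q W) x = 0 := fun x hx => by
  rw [creation, ← map_quad, quad_ι hx, map_zero]

theorem lift_creation : lift (creation Q W) (quad_creation Q W) = leftMul Q W :=
  algHom_ext (lift_ι _ _)

theorem tensor_submodule_eq_top {S : Submodule ℂ (QuadAlg Q ⊗[ℂ] W)} (one : ∀ w, 1 ⊗ₜ w ∈ S)
    (creation : ∀ m, ∀ x ∈ S, creation Q W m x ∈ S) : S = ⊤ := by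
  have hpure : ∀ a (w : W), a ⊗ₜ w ∈ S := by
    have : ⨅ w : W, S.comap ((TensorProduct.mk ℂ (QuadAlg Q) W).flip w) = ⊤ :=
      submodule_eq_top (by simpa using one) fun m a ha => by
        simp only [Submodule.mem_iInf] at ha ⊢
        exact fun w => creation m _ (ha w)
    intro a w
    exact (Submodule.mem_iInf _).mp (this ▸ Submodule.mem_top : a ∈ _) w
  refine eq_top_iff.mpr fun x _ => ?_
  induction x using TensorProduct.induction_on with
  | zero => exact S.zero_mem
  | add x y hx hy => exact S.add_mem (hx trivial) (hy trivial)
  | tmul a w => exact hpure a w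

theorem tensor_hom_ext {φ ψ : QuadAlg Q ⊗[ℂ] W →ₗ[ℂ] P}
    (one : ∀ w, φ (1 ⊗ₜ w) = ψ (1 ⊗ₜ w))
    (creation : ∀ m x, φ x = ψ x → φ (creation Q W m x) = ψ (creation Q W m x)) : φ = ψ :=
  LinearMap.eqLocus_eq_top.mp (tensor_submodule_eq_top one creation)

section MulMap

variable (j : M →ₗ[ℂ] A) (hj : ∀ x ∈ Q, quad j x = 0) (k : W →ₗ[ℂ] A)

/-- The linear map `a ⊗ w ↦ j(a) k(w)` on `QuadAlg Q ⊗ W`, with `j` extended to `QuadAlg Q`. -/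
def mulMap : QuadAlg Q ⊗[ℂ] W →ₗ[ℂ] A :=
  TensorProduct.lift ((LinearMap.mul ℂ A).compl₁₂ (lift j hj).toLinearMap k)

@[simp] theorem mulMap_one_tmul (w : W) : mulMap j hj k (1 ⊗ₜ w) = k w := by simp [mulMap]

@[simp] theorem mulMap_creation (m : M) (x : QuadAlg Q ⊗[ℂ] W) :
    mulMap j hj k (creation Q W m x) = j m * mulMap j hj k x := by
  induction x using TensorProduct.induction_on with
  | zero => simp
  | add x y hx hy => simp only [map_add, hx, hy, mul_add]
  | tmul a w => simp [mulMap, mul_assoc]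

theorem mul_mem_range_mulMap_of_mem (m : M) {y : A} (hy : y ∈ (mulMap j hj k).range) :
    j m * y ∈ (mulMap j hj k).range := by
  obtain ⟨x, rfl⟩ := hy
  exact ⟨creation Q W m x, mulMap_creation j hj k m x⟩

variable {j hj k}

theorem mul_mem_range_mulMap {a : A} (one : ∀ w, a * k w ∈ (mulMap j hj k).range)
    (creation : ∀ m, ∀ y ∈ (mulMap j hj k).range, a * y ∈ (mulMap j hj k).range →
      a * (j m * y) ∈ (mulMap j hj k).range) :
    ∀ y ∈ (mulMap j hj k).range, a * y ∈ (mulMap j hj k).range := by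
  have : (mulMap j hj k).range.comap (LinearMap.mulLeft ℂ a ∘ₗ mulMap j hj k) = ⊤ :=
    tensor_submodule_eq_top (by simpa using one) fun m x hx => by
      simpa using creation m _ ⟨x, rfl⟩ hx
  rintro _ ⟨x, rfl⟩
  exact (this ▸ Submodule.mem_top : x ∈ _)

end MulMap

section TwistedDerivation

variable (b : M →ₗ[ℂ] Module.End ℂ (QuadAlg Q ⊗[ℂ] W))
  (hb : ∀ x ∈ Q, polar (creation Q W) b x = 0)

/-- The operator `D` on `QuadAlg Q ⊗ W` with `D(1 ⊗ w) = 1 ⊗ χ(w)` and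
`D(m · x) = m · D(x) + b(m) x` for generators `m`; the second summand of the definition reads off
the coefficient of `ε`. -/
def twistedDerivation (χ : Module.End ℂ W) : Module.End ℂ (QuadAlg Q ⊗[ℂ] W) :=
  χ.lTensor (QuadAlg Q) + TensorProduct.lift
    (((TrivSqZeroExt.sndHom _ _).restrictScalars ℂ ∘ₗ
      (liftDualNumber (creation Q W) b (quad_creation Q W) hb).toLinearMap).compl₂
        (TensorProduct.mk ℂ (QuadAlg Q) W 1))

@[simp] theorem twistedDerivation_one_tmul (χ : Module.End ℂ W) (w : W) :
    twistedDerivation b hb χ (1 ⊗ₜ w) = 1 ⊗ₜ χ w := by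
  simp [twistedDerivation]

theorem twistedDerivation_creation (χ : Module.End ℂ W) (m : M) (x : QuadAlg Q ⊗[ℂ] W) :
    twistedDerivation b hb χ (creation Q W m x) =
      creation Q W m (twistedDerivation b hb χ x) + b m x := by
  induction x using TensorProduct.induction_on with
  | zero => simp
  | add x y hx hy =>
    simp only [map_add, hx, hy]
    abel
  | tmul a w =>
    simp [twistedDerivation, liftDualNumber_ι, fst_liftDualNumber, lift_creation, add_assoc]

end TwistedDerivation

end TensorModule

end QuadAlg

end QuadAlg

/-! ## Smash products -/

section Smash

variable {G : Type*} [Group G] {M : Type*} [AddCommGroup M] [Module ℂ M]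
  (ρ : Representation ℂ G M) {A : Type*} [Ring A] [Algebra ℂ A]

/-- The covariance condition `g · j(m) = j(g(m)) · g` on a linear map `j : M → A` out of a
representation of `G` into an algebra with an algebra homomorphism `ℂG → A`. -/
def IsCovariant (Γ : MonoidAlgebra ℂ G →ₐ[ℂ] A) (j : M →ₗ[ℂ] A) : Prop :=
  ∀ g m, Γ (MonoidAlgebra.of ℂ G g) * j m = j (ρ g m) * Γ (MonoidAlgebra.of ℂ G g)

/-- The action of `ℂG` on `M ⊗ ℂG` by left multiplication in the smash product: `m ⊗ a` stands for
the product `m · a`, and `g · m · a = g(m) · ga`. -/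
def smashMul : MonoidAlgebra ℂ G →ₐ[ℂ] Module.End ℂ (M ⊗[ℂ] MonoidAlgebra ℂ G) :=
  (ρ.tprod (Representation.leftRegular ℂ G)).asAlgebraHom

theorem smashMul_of_tmul (g : G) (m : M) (a : MonoidAlgebra ℂ G) :
    smashMul ρ (MonoidAlgebra.of ℂ G g) (m ⊗ₜ a) = ρ g m ⊗ₜ (MonoidAlgebra.of ℂ G g * a) := by
  rw [smashMul, Representation.asAlgebraHom_of, Representation.tprod_apply,
    TensorProduct.map_tmul, ← Representation.asAlgebraHom_of (Representation.leftRegular ℂ G),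
    Representation.asAlgebraHom_ofMulAction_smul_eq_mul]

/-- For `b : M → ℂG`, the linear map `u ⊗ w ↦ u · b(w) + b(u) · w` into the smash product
`M ⊗ ℂG`, linear in `b`. -/
def smashPolar : (M →ₗ[ℂ] MonoidAlgebra ℂ G) →ₗ[ℂ] M ⊗[ℂ] M →ₗ[ℂ] M ⊗[ℂ] MonoidAlgebra ℂ G where
  toFun b := b.lTensor M + TensorProduct.lift (((smashMul ρ).toLinearMap ∘ₗ b).compl₂
    ((TensorProduct.mk ℂ M (MonoidAlgebra ℂ G)).flip 1))
  map_add' b b' := TensorProduct.ext' fun u w => by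
    simp only [LinearMap.add_apply, LinearMap.lTensor_tmul, TensorProduct.lift.tmul,
      LinearMap.compl₂_apply, LinearMap.comp_apply, map_add, TensorProduct.tmul_add]
    abel
  map_smul' r b := TensorProduct.ext' fun u w => by simp

theorem smashPolar_tmul (b : M →ₗ[ℂ] MonoidAlgebra ℂ G) (u w : M) :
    smashPolar ρ b (u ⊗ₜ w) = u ⊗ₜ b w + smashMul ρ (b u) (w ⊗ₜ 1) := rfl

theorem smashPolar_smulRight_one (e : Module.Dual ℂ M) {x : M ⊗[ℂ] M} (hx : x ∈ wedge M) :
    smashPolar ρ (e.smulRight 1) x = 0 :=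
  apply_eq_zero_of_mem_wedge _ (fun u w => by simp [smashPolar_tmul, add_comm]) hx

variable {ρ} {Γ : MonoidAlgebra ℂ G →ₐ[ℂ] A} {j : M →ₗ[ℂ] A}

theorem IsCovariant.mul_lift_mul (hj : IsCovariant ρ Γ j) (a : MonoidAlgebra ℂ G)
    (x : M ⊗[ℂ] MonoidAlgebra ℂ G) :
    TensorProduct.lift ((LinearMap.mul ℂ A).compl₁₂ j Γ.toLinearMap) (smashMul ρ a x) =
      Γ a * TensorProduct.lift ((LinearMap.mul ℂ A).compl₁₂ j Γ.toLinearMap) x := by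
  induction a using MonoidAlgebra.induction_on generalizing x with
  | of g =>
    induction x using TensorProduct.induction_on with
    | zero => simp
    | add x y hx hy => rw [map_add, map_add, map_add, hx, hy, mul_add]
    | tmul m a =>
      rw [smashMul_of_tmul]
      simp [← mul_assoc, hj g m, -MonoidAlgebra.of_apply]
  | add a b ha hb => simp only [map_add, LinearMap.add_apply, ha, hb, add_mul]
  | smul r a ha => simp only [map_smul, LinearMap.smul_apply, ha, smul_mul_assoc]

theorem IsCovariant.polar_eq_zero (hj : IsCovariant ρ Γ j) {b : M →ₗ[ℂ] MonoidAlgebra ℂ G}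
    {x : M ⊗[ℂ] M} (hx : smashPolar ρ b x = 0) : polar j (Γ.toLinearMap ∘ₗ b) x = 0 := by
  have : polar j (Γ.toLinearMap ∘ₗ b) =
      TensorProduct.lift ((LinearMap.mul ℂ A).compl₁₂ j Γ.toLinearMap) ∘ₗ smashPolar ρ b :=
    TensorProduct.ext' fun u w => by
      rw [LinearMap.comp_apply, smashPolar_tmul, map_add, hj.mul_lift_mul]
      simp
  rw [this, LinearMap.comp_apply, hx, map_zero]

variable {Q : Submodule ℂ (M ⊗[ℂ] M)}

theorem IsCovariant.mul_mem_range_mulMap (hj : IsCovariant ρ Γ j)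
    {hquad : ∀ x ∈ Q, quad j x = 0} {W : Type*} [AddCommGroup W] [Module ℂ W] {k : W →ₗ[ℂ] A}
    {g : G} (hk : ∀ w, Γ (MonoidAlgebra.of ℂ G g) * k w ∈ k.range) :
    ∀ y ∈ (QuadAlg.mulMap j hquad k).range,
      Γ (MonoidAlgebra.of ℂ G g) * y ∈ (QuadAlg.mulMap j hquad k).range := by
  refine QuadAlg.mul_mem_range_mulMap (fun w => ?_) fun m y _ hy => ?_
  · obtain ⟨w', hw'⟩ := hk w
    exact ⟨1 ⊗ₜ w', by rw [QuadAlg.mulMap_one_tmul, hw']⟩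
  · rw [← mul_assoc, hj g m, mul_assoc]
    exact QuadAlg.mul_mem_range_mulMap_of_mem j hquad k _ hy

namespace QuadAlg

variable (ρ) (hQ : ∀ g, Q ≤ Q.comap (TensorProduct.map (ρ g) (ρ g)))

/-- The action of `G` by algebra automorphisms on the quadratic algebra of a representation. -/
def rep : Representation ℂ G (QuadAlg Q) where
  toFun g := (map (ρ g) (hQ g)).toLinearMap
  map_one' := by
    have : map (ρ 1) (hQ 1) = AlgHom.id ℂ _ := algHom_ext fun m => by simp
    rw [this]
    rfl
  map_mul' g h := by
    have : map (ρ (g * h)) (hQ (g * h)) = (map (ρ g) (hQ g)).comp (map (ρ h) (hQ h)) :=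
      algHom_ext fun m => by simp
    rw [this]
    rfl

@[simp] theorem rep_one (g : G) : rep ρ hQ g 1 = 1 := map_one (map (ρ g) (hQ g))

theorem rep_ι_mul (g : G) (m : M) (a : QuadAlg Q) :
    rep ρ hQ g (ι Q m * a) = ι Q (ρ g m) * rep ρ hQ g a :=
  (map_mul (map (ρ g) (hQ g)) _ _).trans (congrArg (· * _) (map_ι _ _ m))

variable {W : Type*} [AddCommGroup W] [Module ℂ W] (σ : Representation ℂ G W)

theorem isCovariant_creation :
    IsCovariant ρ ((rep ρ hQ).tprod σ).asAlgebraHom (creation Q W) := fun g m => by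
  rw [Representation.asAlgebraHom_of, Representation.tprod_apply]
  exact TensorProduct.ext' fun a w => by simp [rep_ι_mul]

theorem asAlgebraHom_tprod_one_tmul (a : MonoidAlgebra ℂ G) (w : W) :
    ((rep ρ hQ).tprod σ).asAlgebraHom a (1 ⊗ₜ w) = 1 ⊗ₜ σ.asAlgebraHom a w := by
  induction a using MonoidAlgebra.induction_on with
  | of g =>
    rw [Representation.asAlgebraHom_of, Representation.asAlgebraHom_of,
      Representation.tprod_apply, TensorProduct.map_tmul, rep_one]
  | add a b ha hb =>
    simp only [map_add, LinearMap.add_apply, ha, hb, TensorProduct.tmul_add]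
  | smul r a ha =>
    simp only [map_smul, LinearMap.smul_apply, ha, TensorProduct.tmul_smul]

end QuadAlg

end Smash

/-! ## Triangular decomposition of doubles -/

section Doubles

variable {G : Type*} [Group G] {V : Type*} [AddCommGroup V] [Module ℂ V]
  (ρ : Representation ℂ G V) (β : Module.Dual ℂ V →ₗ[ℂ] V →ₗ[ℂ] MonoidAlgebra ℂ G)
  (Rm : Submodule ℂ (V ⊗[ℂ] V)) (Rp : Submodule ℂ (Module.Dual ℂ V ⊗[ℂ] Module.Dual ℂ V))
  {A : Type*} [Ring A] [Algebra ℂ A]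

namespace Double

/-- The map from `V` to the double. -/
def iV : V →ₗ[ℂ] Double ρ β Rm Rp := (RingQuot.mkAlgHom ℂ _).toLinearMap ∘ₗ genV G

/-- The map from `V*` to the double. -/
def iD : Module.Dual ℂ V →ₗ[ℂ] Double ρ β Rm Rp := (RingQuot.mkAlgHom ℂ _).toLinearMap ∘ₗ genD G

/-- The map from the group algebra to the double. -/
def iG : MonoidAlgebra ℂ G →ₐ[ℂ] Double ρ β Rm Rp :=
  AlgHom.ofLinearMap ((RingQuot.mkAlgHom ℂ _).toLinearMap ∘ₗ genG V)
    ((RingQuot.mkAlgHom_rel ℂ (DoubleRel.one (ρ := ρ))).trans (map_one _))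
    (fun a b => (RingQuot.mkAlgHom_rel ℂ (DoubleRel.mul (ρ := ρ) a b)).trans (map_mul _ _ _))

theorem ι_apply (x : Gens G V) :
    Double.ι ρ β Rm Rp x = iV ρ β Rm Rp x.1 + (iG ρ β Rm Rp x.2.1 + iD ρ β Rm Rp x.2.2) := by
  obtain ⟨v, a, f⟩ := x
  have hsum : ((v, a, f) : Gens G V) = (v, 0, 0) + ((0, a, 0) + (0, 0, f)) := by simp
  conv_lhs => rw [hsum, map_add, map_add]
  rfl

theorem isCovariant_iV : IsCovariant ρ (iG ρ β Rm Rp) (iV ρ β Rm Rp) := fun g v =>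
  ((map_mul _ _ _).symm.trans (RingQuot.mkAlgHom_rel ℂ (DoubleRel.actV g v))).trans
    (map_mul _ _ _)

theorem isCovariant_iD : IsCovariant ρ.dual (iG ρ β Rm Rp) (iD ρ β Rm Rp) := fun g f =>
  ((map_mul _ _ _).symm.trans (RingQuot.mkAlgHom_rel ℂ (DoubleRel.actD g f))).trans
    (map_mul _ _ _)

theorem iD_mul_iV (f : Module.Dual ℂ V) (v : V) :
    iD ρ β Rm Rp f * iV ρ β Rm Rp v =
      iV ρ β Rm Rp v * iD ρ β Rm Rp f + iG ρ β Rm Rp (β f v) := by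
  have hrel := RingQuot.mkAlgHom_rel ℂ (DoubleRel.comm (ρ := ρ) (β := β) (Rm := Rm) (Rp := Rp) f v)
  rw [map_sub, map_mul, map_mul] at hrel
  exact sub_eq_iff_eq_add'.mp hrel

theorem quad_iV : ∀ x ∈ Rm, quad (iV ρ β Rm Rp) x = 0 := fun x hx =>
  (map_quad _ _ x).symm.trans
    ((RingQuot.mkAlgHom_rel ℂ (DoubleRel.quadV x hx)).trans (map_zero _))

theorem quad_iD : ∀ x ∈ Rp, quad (iD ρ β Rm Rp) x = 0 := fun x hx =>
  (map_quad _ _ x).symm.trans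
    ((RingQuot.mkAlgHom_rel ℂ (DoubleRel.quadD x hx)).trans (map_zero _))

theorem submodule_eq_top {S : Submodule ℂ (Double ρ β Rm Rp)} (one_mem : 1 ∈ S)
    (iV_mul_mem : ∀ v, ∀ y ∈ S, iV ρ β Rm Rp v * y ∈ S)
    (iG_mul_mem : ∀ g, ∀ y ∈ S, iG ρ β Rm Rp (MonoidAlgebra.of ℂ G g) * y ∈ S)
    (iD_mul_mem : ∀ f, ∀ y ∈ S, iD ρ β Rm Rp f * y ∈ S) : S = ⊤ := by
  refine submodule_eq_top_of_adjoin_eq_top (adjoin_range_mkAlgHom_comp_ι _) one_mem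
    (Set.forall_mem_range.mpr fun x y hy => ?_)
  change Double.ι ρ β Rm Rp x * y ∈ S
  rw [ι_apply, add_mul, add_mul]
  exact S.add_mem (iV_mul_mem _ y hy) <|
    S.add_mem (algHom_monoidAlgebra_mul_mem _ (iG_mul_mem · y hy) _) (iD_mul_mem _ y hy)

/-- The images of the generators under an algebra homomorphism from a double to `A`, with the
relations that they satisfy. -/
structure Hom (A : Type*) [Ring A] [Algebra ℂ A] where
  jV : V →ₗ[ℂ] A
  jG : MonoidAlgebra ℂ G →ₐ[ℂ] A
  jD : Module.Dual ℂ V →ₗ[ℂ] A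
  isCovariant_jV : IsCovariant ρ jG jV
  isCovariant_jD : IsCovariant ρ.dual jG jD
  jD_mul_jV : ∀ f v, jD f * jV v = jV v * jD f + jG (β f v)
  quad_jV : ∀ x ∈ Rm, quad jV x = 0
  quad_jD : ∀ x ∈ Rp, quad jD x = 0

variable {ρ β Rm Rp}

/-- The universal property of a double. -/
def Hom.lift (j : Hom ρ β Rm Rp A) : Double ρ β Rm Rp →ₐ[ℂ] A :=
  RingQuot.liftAlgHom ℂ ⟨TensorAlgebra.lift ℂ (j.jV.coprod (j.jG.toLinearMap.coprod j.jD)), by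
    set φ := TensorAlgebra.lift ℂ (j.jV.coprod (j.jG.toLinearMap.coprod j.jD)) with hφ
    have hV (v) : φ (genV G v) = j.jV v := by simp [hφ, genV]
    have hG (a) : φ (genG V a) = j.jG a := by simp [hφ, genG]
    have hD (f) : φ (genD G f) = j.jD f := by simp [hφ, genD]
    rintro _ _ (_ | ⟨a, b⟩ | ⟨g, v⟩ | ⟨g, f⟩ | ⟨f, v⟩ | ⟨x, hx⟩ | ⟨x, hx⟩)
    · rw [hG, map_one, map_one]
    · rw [hG, map_mul, map_mul, hG, hG]
    · rw [map_mul, map_mul, hG, hV, hV, j.isCovariant_jV]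
    · rw [map_mul, map_mul, hG, hD, hD, j.isCovariant_jD]
    · rw [map_sub, map_mul, map_mul, hG, hD, hV, j.jD_mul_jV, add_sub_cancel_left]
    · rw [map_quad, map_zero, ← j.quad_jV x hx]
      exact congrArg (quad · x) (LinearMap.ext hV)
    · rw [map_quad, map_zero, ← j.quad_jD x hx]
      exact congrArg (quad · x) (LinearMap.ext hD)⟩

section Lift

variable (j : Hom ρ β Rm Rp A)

@[simp] theorem Hom.lift_iV (v : V) : j.lift (iV ρ β Rm Rp v) = j.jV v := by
  simp [Hom.lift, iV, genV]

@[simp] theorem Hom.lift_iG (a : MonoidAlgebra ℂ G) : j.lift (iG ρ β Rm Rp a) = j.jG a := by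
  simp [Hom.lift, iG, genG]

@[simp] theorem Hom.lift_iD (f : Module.Dual ℂ V) : j.lift (iD ρ β Rm Rp f) = j.jD f := by
  simp [Hom.lift, iD, genD]

end Lift

variable (ρ β Rm Rp) in
/-- The multiplication map `T(V)/(Rm) ⊗ T(V*)/(Rp) ⊗ ℂG → Double`. -/
def triangularMul :
    QuadAlg Rm ⊗[ℂ] (QuadAlg Rp ⊗[ℂ] MonoidAlgebra ℂ G) →ₗ[ℂ] Double ρ β Rm Rp :=
  QuadAlg.mulMap _ (quad_iV ρ β Rm Rp)
    (QuadAlg.mulMap _ (quad_iD ρ β Rm Rp) (iG ρ β Rm Rp).toLinearMap)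

theorem triangularMul_surjective : Function.Surjective (triangularMul ρ β Rm Rp) := by
  have iG_mul_mem (g : G) : ∀ y ∈ (triangularMul ρ β Rm Rp).range,
      iG ρ β Rm Rp (MonoidAlgebra.of ℂ G g) * y ∈ (triangularMul ρ β Rm Rp).range :=
    (isCovariant_iV ρ β Rm Rp).mul_mem_range_mulMap fun z =>
      (isCovariant_iD ρ β Rm Rp).mul_mem_range_mulMap
        (fun a => ⟨MonoidAlgebra.of ℂ G g * a, map_mul (iG ρ β Rm Rp) _ _⟩) _ ⟨z, rfl⟩
  refine LinearMap.range_eq_top.mp (submodule_eq_top ρ β Rm Rp ⟨1 ⊗ₜ (1 ⊗ₜ 1), ?_⟩ ?_ iG_mul_mem ?_)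
  · simp [triangularMul]
  · exact fun v y hy => QuadAlg.mul_mem_range_mulMap_of_mem _ _ _ v hy
  · refine fun f => QuadAlg.mul_mem_range_mulMap (fun z => ⟨1 ⊗ₜ QuadAlg.creation _ _ f z, ?_⟩)
      fun v y hy hfy => ?_
    · simp
    · rw [← mul_assoc, iD_mul_iV, add_mul, mul_assoc]
      exact Submodule.add_mem _ (QuadAlg.mul_mem_range_mulMap_of_mem _ _ _ v hfy)
        (algHom_monoidAlgebra_mul_mem _ (iG_mul_mem · y hy) _)


variable (ρ β Rm Rp) in
/-- Compatibility conditions on the data of a double under which multiplication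
`T(V)/(Rm) ⊗ T(V*)/(Rp) ⊗ ℂG → Double` is bijective. The last two conditions say that commuting a
generator past a quadratic relation of the other half gives zero. -/
structure IsTriangular : Prop where
  map_mem_left : ∀ g, Rm ≤ Rm.comap (TensorProduct.map (ρ g) (ρ g))
  map_mem_right : ∀ g, Rp ≤ Rp.comap (TensorProduct.map (ρ.dual g) (ρ.dual g))
  of_mul_pairing : ∀ g f v, MonoidAlgebra.of ℂ G g * β f v =
    β (ρ.dual g f) (ρ g v) * MonoidAlgebra.of ℂ G g
  smashPolar_left : ∀ f, ∀ x ∈ Rm, smashPolar ρ (β f) x = 0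
  smashPolar_right : ∀ v, ∀ x ∈ Rp, smashPolar ρ.dual (β.flip v) x = 0

namespace IsTriangular

variable (h : IsTriangular ρ β Rm Rp)

section Verma

variable {W : Type*} [AddCommGroup W] [Module ℂ W] (σ : Representation ℂ G W)
  (χ : Module.Dual ℂ V →ₗ[ℂ] Module.End ℂ W)

/-- The action of `ℂG` on the Verma module `QuadAlg Rm ⊗ W`. -/
def groupAction : MonoidAlgebra ℂ G →ₐ[ℂ] Module.End ℂ (QuadAlg Rm ⊗[ℂ] W) :=
  ((QuadAlg.rep ρ h.map_mem_left).tprod σ).asAlgebraHom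

@[simp] theorem groupAction_one_tmul (a : MonoidAlgebra ℂ G) (w : W) :
    h.groupAction σ a (1 ⊗ₜ w) = 1 ⊗ₜ σ.asAlgebraHom a w :=
  QuadAlg.asAlgebraHom_tprod_one_tmul _ _ _ _ _

theorem isCovariant_creation : IsCovariant ρ (h.groupAction σ) (QuadAlg.creation Rm W) :=
  QuadAlg.isCovariant_creation ρ h.map_mem_left σ

/-- The action of `V*` on the Verma module `QuadAlg Rm ⊗ W` which extends the action `χ` on `W` and
satisfies the commutation relation of the double with the creation operators. -/
def annihilation : Module.Dual ℂ V →ₗ[ℂ] Module.End ℂ (QuadAlg Rm ⊗[ℂ] W) where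
  toFun f := QuadAlg.twistedDerivation ((h.groupAction σ).toLinearMap ∘ₗ β f)
    (fun x hx => (h.isCovariant_creation σ).polar_eq_zero (h.smashPolar_left f x hx)) (χ f)
  map_add' f f' := QuadAlg.tensor_hom_ext (fun w => by simp [TensorProduct.tmul_add])
    fun v x hx => by
      simp only [QuadAlg.twistedDerivation_creation, LinearMap.add_apply, hx]
      simp only [LinearMap.comp_apply, LinearMap.add_apply, map_add]
      abel
  map_smul' r f := QuadAlg.tensor_hom_ext (fun w => by simp)
    fun v x hx => by
      simp only [QuadAlg.twistedDerivation_creation, LinearMap.smul_apply, hx]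
      simp only [LinearMap.comp_apply, LinearMap.smul_apply, map_smul, RingHom.id_apply, smul_add]

@[simp] theorem annihilation_one_tmul (f : Module.Dual ℂ V) (w : W) :
    h.annihilation σ χ f (1 ⊗ₜ w) = 1 ⊗ₜ χ f w :=
  QuadAlg.twistedDerivation_one_tmul _ _ _ _

theorem annihilation_creation (f : Module.Dual ℂ V) (v : V) (x : QuadAlg Rm ⊗[ℂ] W) :
    h.annihilation σ χ f (QuadAlg.creation Rm W v x) =
      QuadAlg.creation Rm W v (h.annihilation σ χ f x) + h.groupAction σ (β f v) x :=
  QuadAlg.twistedDerivation_creation _ _ _ _ _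

variable {σ χ}

theorem isCovariant_annihilation (hχ : IsCovariant ρ.dual σ.asAlgebraHom χ) :
    IsCovariant ρ.dual (h.groupAction σ) (h.annihilation σ χ) := fun g f => by
  refine QuadAlg.tensor_hom_ext (fun w => ?_) fun v x hx => ?_
  · simpa only [Module.End.mul_apply, annihilation_one_tmul, groupAction_one_tmul] using
      congrArg ((1 : QuadAlg Rm) ⊗ₜ[ℂ] ·) (LinearMap.congr_fun (hχ g f) w)
  · have hcreation := fun y => LinearMap.congr_fun (h.isCovariant_creation σ g v) y
    have hpairing := congrArg (h.groupAction σ · x) (h.of_mul_pairing g f v)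
    simp only [Module.End.mul_apply, map_mul] at hx hcreation hpairing ⊢
    rw [annihilation_creation, map_add, hcreation, hcreation, annihilation_creation, hx, hpairing]

variable (σ χ) in
theorem quad_annihilation_one_tmul (y : Module.Dual ℂ V ⊗[ℂ] Module.Dual ℂ V) (w : W) :
    quad (h.annihilation σ χ) y (1 ⊗ₜ w) = 1 ⊗ₜ quad χ y w := by
  induction y using TensorProduct.induction_on with
  | zero => simp
  | add y z hy hz => simp only [map_add, LinearMap.add_apply, hy, hz, TensorProduct.tmul_add]
  | tmul f f' => simp

variable (σ χ) in
theorem quad_annihilation_creation (y : Module.Dual ℂ V ⊗[ℂ] Module.Dual ℂ V) (v : V)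
    (z : QuadAlg Rm ⊗[ℂ] W) :
    quad (h.annihilation σ χ) y (QuadAlg.creation Rm W v z) =
      QuadAlg.creation Rm W v (quad (h.annihilation σ χ) y z) +
        polar (h.annihilation σ χ) ((h.groupAction σ).toLinearMap ∘ₗ β.flip v) y z := by
  induction y using TensorProduct.induction_on with
  | zero => simp
  | add y y' hy hy' =>
    simp only [map_add, LinearMap.add_apply, hy, hy']
    abel
  | tmul f f' =>
    simp only [quad_tmul, polar_tmul, Module.End.mul_apply, annihilation_creation, map_add,
      LinearMap.add_apply, LinearMap.comp_apply, AlgHom.coe_toLinearMap, LinearMap.flip_apply]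
    abel

theorem quad_annihilation (hχ : IsCovariant ρ.dual σ.asAlgebraHom χ)
    (hquad : ∀ x ∈ Rp, quad χ x = 0) : ∀ x ∈ Rp, quad (h.annihilation σ χ) x = 0 := fun x hx => by
  have hpolar (v : V) :
      polar (h.annihilation σ χ) ((h.groupAction σ).toLinearMap ∘ₗ β.flip v) x = 0 :=
    (h.isCovariant_annihilation hχ).polar_eq_zero (h.smashPolar_right v x hx)
  refine QuadAlg.tensor_hom_ext (fun w => ?_) fun v z hz => ?_
  · simp [quad_annihilation_one_tmul, hquad x hx]
  · simp [quad_annihilation_creation, hz, hpolar]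

/-- The Verma module `QuadAlg Rm ⊗ W` induced from a module `W` over `T(V*)/(Rp) ⋊ G`. -/
def verma (hχ : IsCovariant ρ.dual σ.asAlgebraHom χ) (hquad : ∀ x ∈ Rp, quad χ x = 0) :
    Hom ρ β Rm Rp (Module.End ℂ (QuadAlg Rm ⊗[ℂ] W)) where
  jV := QuadAlg.creation Rm W
  jG := h.groupAction σ
  jD := h.annihilation σ χ
  isCovariant_jV := h.isCovariant_creation σ
  isCovariant_jD := h.isCovariant_annihilation hχ
  jD_mul_jV f v := LinearMap.ext (h.annihilation_creation σ χ f v)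
  quad_jV := QuadAlg.quad_creation Rm W
  quad_jD := h.quad_annihilation hχ hquad

end Verma

/-- The Verma module induced from the free module of rank one over `T(V*)/(Rp) ⋊ G`. -/
def regular : Hom ρ β Rm Rp
    (Module.End ℂ (QuadAlg Rm ⊗[ℂ] (QuadAlg Rp ⊗[ℂ] MonoidAlgebra ℂ G))) :=
  h.verma (QuadAlg.isCovariant_creation ρ.dual h.map_mem_right (Representation.leftRegular ℂ G))
    (QuadAlg.quad_creation Rp (MonoidAlgebra ℂ G))

theorem regular_lift_triangularMul
    (x : QuadAlg Rm ⊗[ℂ] (QuadAlg Rp ⊗[ℂ] MonoidAlgebra ℂ G)) :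
    h.regular.lift (triangularMul ρ β Rm Rp x) (1 ⊗ₜ (1 ⊗ₜ 1)) = x := by
  let vacuum : QuadAlg Rm ⊗[ℂ] (QuadAlg Rp ⊗[ℂ] MonoidAlgebra ℂ G) := 1 ⊗ₜ (1 ⊗ₜ 1)
  let orbit : Double ρ β Rm Rp →ₗ[ℂ] QuadAlg Rm ⊗[ℂ] (QuadAlg Rp ⊗[ℂ] MonoidAlgebra ℂ G) :=
    LinearMap.applyₗ vacuum ∘ₗ h.regular.lift.toLinearMap
  have orbit_iV (v : V) (d) : orbit (iV ρ β Rm Rp v * d) = QuadAlg.creation Rm _ v (orbit d) := by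
    simp [orbit, regular, verma]
  have orbit_iD (f : Module.Dual ℂ V) (d) (y) (hd : orbit d = 1 ⊗ₜ y) :
      orbit (iD ρ β Rm Rp f * d) = 1 ⊗ₜ QuadAlg.creation Rp _ f y := by
    have : orbit (iD ρ β Rm Rp f * d) = h.regular.jD f (orbit d) := by simp [orbit]
    rw [this, hd]
    exact h.annihilation_one_tmul _ _ f y
  have orbit_iG (a : MonoidAlgebra ℂ G) : orbit (iG ρ β Rm Rp a) = 1 ⊗ₜ (1 ⊗ₜ a) := by
    simp [orbit, vacuum, regular, verma, QuadAlg.asAlgebraHom_tprod_one_tmul,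
      Representation.asAlgebraHom_ofMulAction_smul_eq_mul]
  have orbit_mulMap : orbit ∘ₗ QuadAlg.mulMap _ (quad_iD ρ β Rm Rp) (iG ρ β Rm Rp).toLinearMap =
      TensorProduct.mk ℂ _ _ 1 :=
    QuadAlg.tensor_hom_ext (fun a => by simp [orbit_iG]) fun f y hy => by
      simpa using orbit_iD f _ y hy
  have orbit_triangularMul : orbit ∘ₗ triangularMul ρ β Rm Rp = LinearMap.id :=
    QuadAlg.tensor_hom_ext
      (fun y => by simpa [triangularMul] using LinearMap.congr_fun orbit_mulMap y)
      fun v x hx => by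
        rw [LinearMap.comp_apply, triangularMul, QuadAlg.mulMap_creation, orbit_iV]
        exact congrArg _ hx
  exact LinearMap.congr_fun orbit_triangularMul x

end IsTriangular

theorem IsTriangular.triangularMul_injective (h : IsTriangular ρ β Rm Rp) :
    Function.Injective (triangularMul ρ β Rm Rp) :=
  Function.LeftInverse.injective
    (g := fun d => h.regular.lift d (1 ⊗ₜ (1 ⊗ₜ 1))) h.regular_lift_triangularMul

section Functoriality

variable {V' : Type*} [AddCommGroup V'] [Module ℂ V'] {ρ' : Representation ℂ G V'}
  {β' : Module.Dual ℂ V' →ₗ[ℂ] V' →ₗ[ℂ] MonoidAlgebra ℂ G} {Rm' : Submodule ℂ (V' ⊗[ℂ] V')}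
  {Rp' : Submodule ℂ (Module.Dual ℂ V' ⊗[ℂ] Module.Dual ℂ V')}
  {μ : V →ₗ[ℂ] V'} {ν : Module.Dual ℂ V →ₗ[ℂ] Module.Dual ℂ V'}

variable (ρ β Rm Rp ρ' β' Rm' Rp' μ ν) in
/-- A pair of `G`-equivariant maps `μ : V → V'` and `ν : V* → V'*` which is compatible with the
pairings and the quadratic relations of two doubles. -/
structure IsCompatible : Prop where
  map_rep : ∀ g v, μ (ρ g v) = ρ' g (μ v)
  map_dual : ∀ g f, ν (ρ.dual g f) = ρ'.dual g (ν f)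
  pairing_map : ∀ f v, β' (ν f) (μ v) = β f v
  map_left : Rm ≤ Rm'.comap (TensorProduct.map μ μ)
  map_right : Rp ≤ Rp'.comap (TensorProduct.map ν ν)

variable (hμν : IsCompatible ρ β Rm Rp ρ' β' Rm' Rp' μ ν)

/-- The algebra homomorphism of doubles which is given by `μ`, `id` and `ν` on the generators. -/
def map : Double ρ β Rm Rp →ₐ[ℂ] Double ρ' β' Rm' Rp' :=
  Hom.lift
    { jV := iV ρ' β' Rm' Rp' ∘ₗ μ
      jG := iG ρ' β' Rm' Rp'
      jD := iD ρ' β' Rm' Rp' ∘ₗ ν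
      isCovariant_jV := fun g v => by
        simpa only [LinearMap.comp_apply, hμν.map_rep] using isCovariant_iV ρ' β' Rm' Rp' g (μ v)
      isCovariant_jD := fun g f => by
        simpa only [LinearMap.comp_apply, hμν.map_dual] using isCovariant_iD ρ' β' Rm' Rp' g (ν f)
      jD_mul_jV := fun f v => by
        simpa only [hμν.pairing_map] using! iD_mul_iV ρ' β' Rm' Rp' (ν f) (μ v)
      quad_jV := fun x hx => (quad_comp _ _ x).trans (quad_iV ρ' β' Rm' Rp' _ (hμν.map_left hx))
      quad_jD := fun x hx => (quad_comp _ _ x).trans (quad_iD ρ' β' Rm' Rp' _ (hμν.map_right hx)) }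

@[simp] theorem map_iV (v : V) : map hμν (iV ρ β Rm Rp v) = iV ρ' β' Rm' Rp' (μ v) :=
  Hom.lift_iV _ v

@[simp] theorem map_iG (a : MonoidAlgebra ℂ G) :
    map hμν (iG ρ β Rm Rp a) = iG ρ' β' Rm' Rp' a :=
  Hom.lift_iG _ a

@[simp] theorem map_iD (f : Module.Dual ℂ V) :
    map hμν (iD ρ β Rm Rp f) = iD ρ' β' Rm' Rp' (ν f) :=
  Hom.lift_iD _ f

theorem map_ι (x : Gens G V) :
    map hμν (Double.ι ρ β Rm Rp x) = Double.ι ρ' β' Rm' Rp' (μ x.1, x.2.1, ν x.2.2) := by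
  simp [ι_apply]

theorem map_triangularMul (x : QuadAlg Rm ⊗[ℂ] (QuadAlg Rp ⊗[ℂ] MonoidAlgebra ℂ G)) :
    map hμν (triangularMul ρ β Rm Rp x) =
      triangularMul ρ' β' Rm' Rp'
        (TensorProduct.map (QuadAlg.map μ hμν.map_left).toLinearMap
          (TensorProduct.map (QuadAlg.map ν hμν.map_right).toLinearMap LinearMap.id) x) := by
  have map_mulMap : (map hμν).toLinearMap ∘ₗ
      QuadAlg.mulMap _ (quad_iD ρ β Rm Rp) (iG ρ β Rm Rp).toLinearMap =
      QuadAlg.mulMap _ (quad_iD ρ' β' Rm' Rp') (iG ρ' β' Rm' Rp').toLinearMap ∘ₗ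
        TensorProduct.map (QuadAlg.map ν hμν.map_right).toLinearMap LinearMap.id :=
    QuadAlg.tensor_hom_ext (fun a => by simp) fun f y hy => by
      simp only [LinearMap.comp_apply, AlgHom.toLinearMap_apply] at hy
      simp [QuadAlg.map_creation, hy]
  have map_triangularMul : (map hμν).toLinearMap ∘ₗ triangularMul ρ β Rm Rp =
      triangularMul ρ' β' Rm' Rp' ∘ₗ
        TensorProduct.map (QuadAlg.map μ hμν.map_left).toLinearMap
          (TensorProduct.map (QuadAlg.map ν hμν.map_right).toLinearMap LinearMap.id) :=
    QuadAlg.tensor_hom_ext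
      (fun y => by simpa [triangularMul] using LinearMap.congr_fun map_mulMap y)
      fun v x hx => by
        simp only [LinearMap.comp_apply, AlgHom.toLinearMap_apply, triangularMul] at hx
        simp [triangularMul, QuadAlg.map_creation, hx]
  exact LinearMap.congr_fun map_triangularMul x

theorem map_injective (h' : IsTriangular ρ' β' Rm' Rp')
    (hμ : Function.Injective (QuadAlg.map μ hμν.map_left))
    (hν : Function.Injective (QuadAlg.map ν hμν.map_right)) : Function.Injective (map hμν) := by
  have hcomp : Function.Injective (map hμν ∘ triangularMul ρ β Rm Rp) := by
    rw [show map hμν ∘ triangularMul ρ β Rm Rp = _ from funext (map_triangularMul hμν)]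
    exact h'.triangularMul_injective.comp <| TensorProduct.map_injective_of_flat_flat _ _ hμ <|
      TensorProduct.map_injective_of_flat_flat _ _ hν Function.injective_id
  exact hcomp.of_comp_right triangularMul_surjective

end Functoriality

end Double

end Doubles

/-! ## The double of the Yetter–Drinfeld module -/

section YetterDrinfeld

variable {V : Type*} [AddCommGroup V] [Module ℂ V] {G : Subgroup (V ≃ₗ[ℂ] V)}

@[simp] theorem natRep_apply (g : G) (v : V) : natRep G g v = (g : V ≃ₗ[ℂ] V) v := rfl

theorem Refl.conj_one (s : Refl G) : Refl.conj (1 : G) s = s :=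
  Subtype.ext (by simp [Refl.conj])

theorem Refl.conj_mul (g h : G) (s : Refl G) :
    Refl.conj (g * h) s = Refl.conj g (Refl.conj h s) :=
  Subtype.ext (by simp [Refl.conj, mul_assoc])

theorem Refl.conj_val_mul (g : G) (s : Refl G) : (Refl.conj g s).1 * g = g * s.1 := by
  simp [Refl.conj]

/-- Conjugation by `g` as a permutation of the set of reflections. -/
def Refl.conjEquiv (g : G) : Refl G ≃ Refl G where
  toFun := Refl.conj g
  invFun := Refl.conj g⁻¹
  left_inv s := by rw [← Refl.conj_mul, inv_mul_cancel, Refl.conj_one]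
  right_inv s := by rw [← Refl.conj_mul, mul_inv_cancel, Refl.conj_one]

theorem Y.hom_ext {N : Type*} [AddCommMonoid N] [Module ℂ N] {φ ψ : Y G →ₗ[ℂ] N}
    (h : ∀ s, φ (br s) = ψ (br s)) : φ = ψ :=
  Finsupp.lhom_ext' fun s => LinearMap.ext_ring (h s)

theorem Y.tensor_hom_ext {M N : Type*} [AddCommMonoid M] [Module ℂ M] [AddCommMonoid N]
    [Module ℂ N] {φ ψ : Y G ⊗[ℂ] M →ₗ[ℂ] N}
    (h : ∀ s m, φ (br s ⊗ₜ m) = ψ (br s ⊗ₜ m)) : φ = ψ :=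
  TensorProduct.ext (Y.hom_ext fun s => LinearMap.ext (h s))

variable (R : Roots G)

@[simp] theorem Roots.rep_br (g : G) (s : Refl G) :
    R.rep g (br s) = R.lam g s • br (Refl.conj g s) := by
  simp [Roots.rep, br]

@[simp] theorem Roots.braiding_br_tmul (s : Refl G) (y : Y G) :
    R.braiding (br s ⊗ₜ y) = R.rep s.1 y ⊗ₜ br s := by
  simp [Roots.braiding, br]

theorem Roots.braiding_map_rep (g : G) (x : Y G ⊗[ℂ] Y G) :
    R.braiding (TensorProduct.map (R.rep g) (R.rep g) x) =
      TensorProduct.map (R.rep g) (R.rep g) (R.braiding x) := by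
  have : R.braiding ∘ₗ TensorProduct.map (R.rep g) (R.rep g) =
      TensorProduct.map (R.rep g) (R.rep g) ∘ₗ R.braiding :=
    Y.tensor_hom_ext fun s y => by
      simp only [LinearMap.comp_apply, TensorProduct.map_tmul, rep_br, braiding_br_tmul,
        ← TensorProduct.smul_tmul', map_smul, TensorProduct.tmul_smul]
      rw [← Module.End.mul_apply, ← Module.End.mul_apply, ← map_mul, ← map_mul,
        Refl.conj_val_mul]
  exact LinearMap.congr_fun this x

theorem Roots.map_rep_mem_quadRel (g : G) :
    R.quadRel ≤ R.quadRel.comap (TensorProduct.map (R.rep g) (R.rep g)) := by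
  rintro x ⟨hx, hx'⟩
  refine ⟨?_, map_mem_wedge _ hx'⟩
  rw [SetLike.mem_coe, LinearMap.mem_ker, LinearMap.add_apply, LinearMap.id_apply] at hx ⊢
  rw [braiding_map_rep, ← map_add, hx, map_zero]

theorem Roots.map_dual_rep_mem_quadRelDual (g : G) :
    R.quadRelDual ≤ R.quadRelDual.comap (TensorProduct.map (R.rep.dual g) (R.rep.dual g)) := by
  rintro p ⟨hp, hp'⟩
  refine ⟨LinearMap.ext fun x => ?_, map_mem_wedge _ hp'⟩
  have hdual : R.rep.dual g = (R.rep g⁻¹).dualMap := rfl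
  have hpx := LinearMap.congr_fun hp (TensorProduct.map (R.rep g⁻¹) (R.rep g⁻¹) x)
  simpa [hdual, dualDistrib_map_dualMap, ← braiding_map_rep] using hpx

section Pairing

variable [Finite G]

theorem pairingY_br (t : ℂ) (f : Module.Dual ℂ (Y G)) (s : Refl G) :
    pairingY G t f (br s) = f (br s) • (MonoidAlgebra.of ℂ G s.1 + t • 1) := by
  classical
  simp only [pairingY, LinearMap.sum_apply, LinearMap.mk₂_apply]
  rw [Finset.sum_eq_single s]
  · simp [brDual, br]
  · intro r _ hr
    simp [brDual, br, Ne.symm hr]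
  · simp

theorem pairingY_zero_br (f : Module.Dual ℂ (Y G)) (s : Refl G) :
    pairingY G 0 f (br s) = f (br s) • MonoidAlgebra.of ℂ G s.1 := by
  rw [pairingY_br, zero_smul, add_zero]

theorem pairingY_eq_zero_add (t : ℂ) (f : Module.Dual ℂ (Y G)) :
    pairingY G t f = pairingY G 0 f + (t • f).smulRight 1 :=
  Y.hom_ext fun s => by
    simp only [pairingY_br, LinearMap.add_apply, LinearMap.smulRight_apply, LinearMap.smul_apply]
    module

theorem pairingY_flip_eq_zero_add (t : ℂ) (y : Y G) :
    (pairingY G t).flip y =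
      (pairingY G 0).flip y + (t • Module.Dual.eval ℂ (Y G) y).smulRight 1 :=
  LinearMap.ext fun f => by
    simpa using LinearMap.congr_fun (pairingY_eq_zero_add t f) y

theorem Roots.of_mul_pairingY (t : ℂ) (g : G) (f : Module.Dual ℂ (Y G)) (y : Y G) :
    MonoidAlgebra.of ℂ G g * pairingY G t f y =
      pairingY G t (R.rep.dual g f) (R.rep g y) * MonoidAlgebra.of ℂ G g := by
  have : LinearMap.mulLeft ℂ (MonoidAlgebra.of ℂ G g) ∘ₗ pairingY G t f =
      LinearMap.mulRight ℂ (MonoidAlgebra.of ℂ G g) ∘ₗ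
        pairingY G t (R.rep.dual g f) ∘ₗ R.rep g :=
    Y.hom_ext fun s => by
      have hpair : R.lam g s * R.rep.dual g f (br (Refl.conj g s)) = f (br s) := by
        rw [← smul_eq_mul, ← map_smul, ← rep_br, Representation.dual_apply,
          Module.Dual.transpose_apply, LinearMap.comp_apply, Representation.inv_self_apply]
      simp only [LinearMap.comp_apply, LinearMap.mulLeft_apply, LinearMap.mulRight_apply, rep_br,
        map_smul, pairingY_br, smul_smul, hpair, mul_smul_comm, smul_mul_assoc, mul_add, add_mul,
        mul_one, one_mul]
      rw [← map_mul, ← map_mul, Refl.conj_val_mul]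
  exact LinearMap.congr_fun this y

theorem Roots.smashPolar_pairingY_zero (f : Module.Dual ℂ (Y G)) (x : Y G ⊗[ℂ] Y G) :
    smashPolar R.rep (pairingY G 0 f) x = (pairingY G 0 f).lTensor (Y G) (x + R.braiding x) := by
  have : smashPolar R.rep (pairingY G 0 f) =
      (pairingY G 0 f).lTensor (Y G) ∘ₗ (LinearMap.id + R.braiding) :=
    Y.tensor_hom_ext fun s y => by
      rw [smashPolar_tmul, pairingY_zero_br, map_smul, LinearMap.smul_apply, smashMul_of_tmul]
      simp [pairingY_zero_br, -MonoidAlgebra.of_apply]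
  exact LinearMap.congr_fun this x

theorem Roots.smashPolar_pairingY_zero_flip_br (s : Refl G)
    (p : Module.Dual ℂ (Y G) ⊗[ℂ] Module.Dual ℂ (Y G)) :
    smashPolar R.rep.dual ((pairingY G 0).flip (br s)) p =
      ((LinearMap.id + R.braiding).dualMap (TensorProduct.dualDistrib ℂ (Y G) (Y G) p) ∘ₗ
        TensorProduct.mk ℂ (Y G) (Y G) (br s) ∘ₗ R.rep s.1⁻¹) ⊗ₜ MonoidAlgebra.of ℂ G s.1 := by
  induction p using TensorProduct.induction_on with
  | zero => simp
  | add p q hp hq =>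
    rw [map_add, hp, hq, map_add, map_add, LinearMap.add_comp, TensorProduct.add_tmul]
  | tmul f f' =>
    rw [smashPolar_tmul, LinearMap.flip_apply, LinearMap.flip_apply, pairingY_zero_br,
      pairingY_zero_br, map_smul, LinearMap.smul_apply, smashMul_of_tmul, mul_one,
      TensorProduct.tmul_smul, TensorProduct.smul_tmul', TensorProduct.smul_tmul',
      ← TensorProduct.add_tmul]
    congr 1
    refine LinearMap.ext fun y => ?_
    simp only [Representation.dual_apply, Module.Dual.transpose_apply, LinearMap.add_apply,
      LinearMap.smul_apply, smul_eq_mul, LinearMap.comp_apply, TensorProduct.mk_apply,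
      LinearMap.dualMap_apply, LinearMap.id_apply, braiding_br_tmul,
      Representation.self_inv_apply, map_add, TensorProduct.dualDistrib_apply]
    ring

theorem Roots.isTriangular (t : ℂ) :
    Double.IsTriangular R.rep (pairingY G t) R.quadRel R.quadRelDual where
  map_mem_left := R.map_rep_mem_quadRel
  map_mem_right := R.map_dual_rep_mem_quadRelDual
  of_mul_pairing := R.of_mul_pairingY t
  smashPolar_left f x := fun ⟨hx, hx'⟩ => by
    have hbraid : x + R.braiding x = 0 := hx
    rw [pairingY_eq_zero_add, map_add, LinearMap.add_apply, smashPolar_smulRight_one _ _ hx',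
      smashPolar_pairingY_zero, hbraid, map_zero, add_zero]
  smashPolar_right y p := fun ⟨hp, hp'⟩ => by
    have hflip : (smashPolar R.rep.dual).flip p ∘ₗ (pairingY G 0).flip = 0 :=
      Y.hom_ext fun s => by
        have hbraid : (LinearMap.id + R.braiding).dualMap
          (TensorProduct.dualDistrib ℂ (Y G) (Y G) p) = 0 := hp
        simp [smashPolar_pairingY_zero_flip_br, hbraid]
    rw [pairingY_flip_eq_zero_add, map_add, LinearMap.add_apply,
      smashPolar_smulRight_one _ _ hp', add_zero]
    exact LinearMap.congr_fun hflip y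

end Pairing

end YetterDrinfeld

/-! ## The embedding of the rational Cherednik algebra -/

section Embedding

variable {V : Type*} [AddCommGroup V] [Module ℂ V] {G : Subgroup (V ≃ₗ[ℂ] V)} (R : Roots G)

/-- The linear map `Y_G → V`, `[s] ↦ α̌_s`, whose transpose is the component `V* → Y_G*` of
`M_c`. -/
def Roots.toV : Y G →ₗ[ℂ] V := Finsupp.linearCombination ℂ R.coroot

@[simp] theorem Roots.toV_br (s : Refl G) : R.toV (br s) = R.coroot s := by
  simp [Roots.toV, br]

theorem Roots.toV_rep (g : G) (y : Y G) : R.toV (R.rep g y) = natRep G g (R.toV y) := by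
  have : R.toV ∘ₗ R.rep g = natRep G g ∘ₗ R.toV :=
    Y.hom_ext fun s => by simp [R.lam_spec g s]
  exact LinearMap.congr_fun this y

theorem Roots.toV_dualMap_dual (g : G) (f : Module.Dual ℂ V) :
    R.toV.dualMap ((natRep G).dual g f) = R.rep.dual g (R.toV.dualMap f) :=
  LinearMap.ext fun y => (congrArg f (R.toV_rep g⁻¹ y)).symm

theorem Roots.natRep_refl (s : Refl G) (v : V) :
    natRep G s.1 v = v - R.root s v • R.coroot s := R.apply_eq s v

theorem Roots.root_conj (g : G) (s : Refl G) (v : V) :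
    R.root (Refl.conj g s) (natRep G g v) = R.lam g s * R.root s v := by
  have hconj : natRep G (Refl.conj g s).1 (natRep G g v) = natRep G g (natRep G s.1 v) := by
    rw [← Module.End.mul_apply, ← Module.End.mul_apply, ← map_mul, ← map_mul, Refl.conj_val_mul]
  rw [natRep_refl, natRep_refl, map_sub, map_smul, natRep_apply g (R.coroot s), lam_spec,
    smul_smul, mul_comm] at hconj
  exact smul_left_injective ℂ (R.coroot_ne_zero _) (sub_right_injective hconj)

theorem Roots.map_toV_dualMap_mem_quadRelDual : wedge (Module.Dual ℂ V) ≤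
    R.quadRelDual.comap (TensorProduct.map R.toV.dualMap R.toV.dualMap) := fun p hp => by
  refine ⟨?_, map_mem_wedge _ hp⟩
  refine apply_eq_zero_of_mem_wedge (((LinearMap.id + R.braiding).dualMap ∘ₗ
    TensorProduct.dualDistrib ℂ (Y G) (Y G)) ∘ₗ TensorProduct.map R.toV.dualMap R.toV.dualMap)
      (fun f f' => Y.tensor_hom_ext fun s y => ?_) hp
  simp only [LinearMap.comp_apply, TensorProduct.map_tmul, LinearMap.dualMap_apply,
    LinearMap.add_apply, LinearMap.id_apply, braiding_br_tmul, map_add,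
    TensorProduct.dualDistrib_apply, toV_br, R.toV_rep, R.natRep_refl, map_sub, map_smul,
    smul_eq_mul]
  ring

variable [Finite G]

/-- The component `V → Y_G`, `v ↦ ∑_s c_s⟨α_s, v⟩[s]` of `M_c`. -/
def Roots.ofV (c : Refl G → ℂ) : V →ₗ[ℂ] Y G :=
  ∑ s : Refl G, c s • (R.root s).smulRight (br s)

theorem Roots.ofV_apply (c : Refl G → ℂ) (v : V) :
    R.ofV c v = ∑ s : Refl G, (c s * R.root s v) • br s := by
  simp [Roots.ofV, LinearMap.sum_apply, mul_smul]

theorem Roots.M_apply (c : Refl G → ℂ) (x : Gens G V) :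
    R.M c x = (R.ofV c x.1, x.2.1, R.toV.dualMap x.2.2) := by
  classical
  have htoV : (∑ s : Refl G, (Module.Dual.eval ℂ V (R.coroot s)).smulRight (brDual G s)) =
      R.toV.dualMap :=
    LinearMap.ext fun f => Y.hom_ext fun s => by
      simp [brDual, LinearMap.sum_apply, br, Finsupp.single_apply, Roots.toV]
  rw [Roots.M, htoV]
  rfl

theorem Roots.ofV_natRep (c : ClassFun G) (g : G) (v : V) :
    R.ofV c (natRep G g v) = R.rep g (R.ofV c v) := by
  rw [ofV_apply, ofV_apply, map_sum, ← Equiv.sum_comp (Refl.conjEquiv g)]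
  refine Finset.sum_congr rfl fun s _ => ?_
  have hc : (c : Refl G → ℂ) (Refl.conj g s) = (c : Refl G → ℂ) s := c.2 g s
  rw [Refl.conjEquiv, Equiv.coe_fn_mk, hc, root_conj, map_smul, rep_br, smul_smul, mul_left_comm,
    mul_comm]

theorem Roots.toV_ofV (c : Refl G → ℂ) (v : V) :
    R.toV (R.ofV c v) = ∑ s : Refl G, c s • (v - natRep G s.1 v) := by
  rw [ofV_apply, map_sum]
  refine Finset.sum_congr rfl fun s _ => ?_
  rw [natRep_refl, map_smul, toV_br, sub_sub_cancel, mul_smul]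

theorem Roots.braiding_ofV_tmul (c : ClassFun G) (v w : V) :
    R.braiding (R.ofV c v ⊗ₜ R.ofV c w) = R.ofV c w ⊗ₜ R.ofV c v -
      ∑ s : Refl G, ((c : Refl G → ℂ) s * (R.root s v * R.root s w)) •
        R.ofV c (R.coroot s) ⊗ₜ[ℂ] br s := by
  rw [R.ofV_apply _ v, TensorProduct.sum_tmul, map_sum, TensorProduct.tmul_sum,
    ← Finset.sum_sub_distrib]
  refine Finset.sum_congr rfl fun s _ => ?_
  rw [← TensorProduct.smul_tmul', map_smul, braiding_br_tmul, ← ofV_natRep, natRep_refl, map_sub,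
    map_smul, TensorProduct.sub_tmul, TensorProduct.tmul_smul, ← TensorProduct.smul_tmul',
    smul_sub, smul_smul, mul_assoc]

theorem Roots.map_ofV_mem_quadRel (c : ClassFun G) :
    wedge V ≤ R.quadRel.comap (TensorProduct.map (R.ofV c) (R.ofV c)) := fun p hp => by
  refine ⟨?_, map_mem_wedge _ hp⟩
  refine apply_eq_zero_of_mem_wedge
    ((LinearMap.id + R.braiding) ∘ₗ TensorProduct.map (R.ofV c) (R.ofV c)) (fun v w => ?_) hp
  simp only [LinearMap.comp_apply, LinearMap.add_apply, LinearMap.id_apply,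
    TensorProduct.map_tmul, braiding_ofV_tmul, mul_comm (R.root _ w)]
  abel

theorem pairingV_apply (t : ℂ) (c : Refl G → ℂ) (f : Module.Dual ℂ V) (v : V) :
    pairingV G t c f v = (t * f v) • (1 : MonoidAlgebra ℂ G) +
      ∑ s : Refl G, (c s * f (v - natRep G s.1 v)) • MonoidAlgebra.of ℂ G s.1 := by
  simp [pairingV, LinearMap.sum_apply]

variable {c : ClassFun G} {t t' k : ℂ}

theorem Roots.pairingY_toV_ofV (hk : ∀ v, R.toV (R.ofV c v) = k • v) (ht : t = t' * k)
    (f : Module.Dual ℂ V) (v : V) :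
    pairingY G t' (R.toV.dualMap f) (R.ofV c v) = pairingV G t c f v := by
  have htv : t * f v = ∑ s : Refl G, t' * ((c : Refl G → ℂ) s * f (v - natRep G s.1 v)) := by
    rw [ht, ← Finset.mul_sum, mul_assoc, ← smul_eq_mul k, ← map_smul, ← hk, toV_ofV, map_sum]
    simp only [map_smul, smul_eq_mul]
  rw [pairingV_apply, htv, Finset.sum_smul, ← Finset.sum_add_distrib, ofV_apply, map_sum]
  refine Finset.sum_congr rfl fun s _ => ?_
  rw [natRep_refl, sub_sub_cancel, map_smul, map_smul, pairingY_br, LinearMap.dualMap_apply, toV_br]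
  module

theorem Roots.isCompatible (hk : ∀ v, R.toV (R.ofV c v) = k • v) (ht : t = t' * k) :
    Double.IsCompatible (natRep G) (pairingV G t c) (wedge V) (wedge (Module.Dual ℂ V))
      R.rep (pairingY G t') R.quadRel R.quadRelDual (R.ofV c) R.toV.dualMap where
  map_rep := R.ofV_natRep c
  map_dual := R.toV_dualMap_dual
  pairing_map := R.pairingY_toV_ofV hk ht
  map_left := R.map_ofV_mem_quadRel c
  map_right := R.map_toV_dualMap_mem_quadRelDual

theorem Roots.quadAlgMap_ofV_injective (hk : ∀ v, R.toV (R.ofV c v) = k • v) (hk0 : k ≠ 0) :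
    Function.Injective (QuadAlg.map (R.ofV c) (R.map_ofV_mem_quadRel c)) :=
  QuadAlg.map_injective _ (η := k⁻¹ • R.toV) (fun _ hx => map_mem_wedge _ hx.2) fun v => by
    rw [LinearMap.smul_apply, hk, inv_smul_smul₀ hk0]

theorem Roots.quadAlgMap_toV_dualMap_injective (hk : ∀ v, R.toV (R.ofV c v) = k • v)
    (hk0 : k ≠ 0) : Function.Injective
      (QuadAlg.map R.toV.dualMap R.map_toV_dualMap_mem_quadRelDual) :=
  QuadAlg.map_injective _ (η := k⁻¹ • (R.ofV c).dualMap) (fun _ hx => map_mem_wedge _ hx.2)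
    fun f => LinearMap.ext fun v => by simp [hk, hk0]

theorem Roots.exists_injective_algHom (hk : ∀ v, R.toV (R.ofV c v) = k • v) (hk0 : k ≠ 0)
    (ht : t = t' * k) :
    ∃ Φ : Cherednik G t c →ₐ[ℂ] R.DeformedDouble t', Function.Injective Φ ∧
      ∀ x : Gens G V, Φ (cherednikι G t c x) = R.deformedι t' (R.M c x) :=
  ⟨Double.map (R.isCompatible hk ht),
    Double.map_injective _ (R.isTriangular t') (R.quadAlgMap_ofV_injective hk hk0)
      (R.quadAlgMap_toV_dualMap_injective hk hk0),
    fun x => by rw [cherednikι, deformedι, Double.map_ι, M_apply]⟩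

end Embedding

/-! ## The functional `κ` -/

section Kappa

theorem re_pos_of_norm_one_sub_eq_one {a : ℂ} (ha : a ≠ 0) (hnorm : ‖1 - a‖ = 1) : 0 < a.re := by
  have hsq : ‖1 - a‖ ^ 2 = 1 - 2 * a.re + Complex.normSq a := by
    rw [Complex.sq_norm, Complex.normSq_apply, Complex.normSq_apply]
    simp only [Complex.sub_re, Complex.sub_im, Complex.one_re, Complex.one_im]
    ring
  rw [hnorm] at hsq
  linarith [Complex.normSq_pos.mpr ha]

variable {V : Type*} [AddCommGroup V] [Module ℂ V] {G : Subgroup (V ≃ₗ[ℂ] V)}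

theorem nonempty_refl_of_closure_eq_top [Nontrivial G]
    (hgen : Subgroup.closure {s : G | IsComplexReflection (s : V ≃ₗ[ℂ] V)} = ⊤) :
    Nonempty (Refl G) := by
  by_contra hempty
  have : {s : G | IsComplexReflection (s : V ≃ₗ[ℂ] V)} = ∅ :=
    Set.eq_empty_of_forall_notMem fun s hs => hempty ⟨⟨s, hs⟩⟩
  rw [this, Subgroup.closure_empty] at hgen
  exact bot_ne_top hgen

variable (R : Roots G)

theorem Roots.natRep_pow_coroot (s : Refl G) (n : ℕ) :
    natRep G (s.1 ^ n) (R.coroot s) = (1 - R.root s (R.coroot s)) ^ n • R.coroot s := by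
  induction n with
  | zero => simp
  | succ n ih =>
    rw [pow_succ', map_mul, Module.End.mul_apply, ih, map_smul, natRep_refl, pow_succ, mul_smul,
      sub_smul, one_smul]

theorem Roots.natRep_pow_of_root_coroot_eq_zero {s : Refl G} (h : R.root s (R.coroot s) = 0)
    (n : ℕ) (v : V) : natRep G (s.1 ^ n) v = v - (n * R.root s v) • R.coroot s := by
  induction n with
  | zero => simp
  | succ n ih =>
    rw [pow_succ', map_mul, Module.End.mul_apply, ih, map_sub, map_smul, natRep_refl, natRep_refl,
      h, Nat.cast_succ]
    module

variable [Finite G]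

theorem Roots.root_coroot_ne_zero (s : Refl G) : R.root s (R.coroot s) ≠ 0 := by
  intro h
  obtain ⟨v, hv⟩ := R.exists_root_eq_one s
  have hpow := R.natRep_pow_of_root_coroot_eq_zero h (orderOf s.1) v
  rw [pow_orderOf_eq_one, map_one, Module.End.one_apply, hv, mul_one, eq_comm, sub_eq_self] at hpow
  exact (smul_ne_zero (Nat.cast_ne_zero.mpr (orderOf_pos s.1).ne') (R.coroot_ne_zero s)) hpow

theorem Roots.norm_one_sub_root_coroot (s : Refl G) : ‖1 - R.root s (R.coroot s)‖ = 1 := by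
  have hpow := R.natRep_pow_coroot s (orderOf s.1)
  rw [pow_orderOf_eq_one, map_one, Module.End.one_apply] at hpow
  refine Complex.norm_eq_one_of_pow_eq_one ?_ (orderOf_pos s.1).ne'
  exact smul_left_injective ℂ (R.coroot_ne_zero s) (by simpa using hpow.symm)

theorem Roots.re_root_coroot_pos (s : Refl G) : 0 < (R.root s (R.coroot s)).re :=
  re_pos_of_norm_one_sub_eq_one (R.root_coroot_ne_zero s) (R.norm_one_sub_root_coroot s)

/-- The functional `κ` on `ℂ(S)^G`: since `⟨α_s, α̌_s⟩` is the trace of `1 - s`, its value `κ(c)` is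
the trace of `∑_s c_s(1 - s)` divided by `dim V`. -/
def Roots.kappa : ClassFun G →ₗ[ℂ] ℂ :=
  (Module.finrank ℂ V : ℂ)⁻¹ •
    (∑ s : Refl G, R.root s (R.coroot s) • LinearMap.proj s) ∘ₗ (ClassFun G).subtype

theorem Roots.kappa_apply (c : ClassFun G) : R.kappa c =
    (Module.finrank ℂ V : ℂ)⁻¹ * ∑ s : Refl G, (c : Refl G → ℂ) s * R.root s (R.coroot s) := by
  simp [Roots.kappa, mul_comm]

variable [FiniteDimensional ℂ V]

theorem Roots.trace_toV_ofV (c : Refl G → ℂ) :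
    LinearMap.trace ℂ V (R.toV ∘ₗ R.ofV c) = ∑ s : Refl G, c s * R.root s (R.coroot s) := by
  have : R.toV ∘ₗ R.ofV c = ∑ s : Refl G, c s • (R.root s).smulRight (R.coroot s) := by
    ext v
    simp [Roots.ofV, LinearMap.sum_apply]
  simp [this, LinearMap.trace_smulRight]

theorem Roots.exists_toV_ofV_eq_smul (hirr : (natRep G).IsIrreducible) (c : ClassFun G) :
    ∃ k : ℂ, ∀ v, R.toV (R.ofV c v) = k • v := by
  let T : Representation.IntertwiningMap (natRep G) (natRep G) :=
    ⟨R.toV ∘ₗ R.ofV c, fun g => LinearMap.ext fun v => by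
      simp only [LinearMap.comp_apply, ofV_natRep, toV_rep]⟩
  obtain ⟨k, hk⟩ :=
    (Representation.IsIrreducible.algebraMap_intertwiningMap_bijective_of_isAlgClosed
      (ρ := natRep G)).2 T
  refine ⟨k, fun v => ?_⟩
  change T v = k • v
  rw [← hk, Algebra.algebraMap_eq_smul_one]
  rfl

theorem Roots.toV_ofV_eq_kappa_smul (hirr : (natRep G).IsIrreducible) (c : ClassFun G) (v : V) :
    R.toV (R.ofV c v) = R.kappa c • v := by
  obtain ⟨k, hk⟩ := R.exists_toV_ofV_eq_smul hirr c
  rcases subsingleton_or_nontrivial V with _ | _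
  · exact Subsingleton.elim _ _
  have hscalar : R.toV ∘ₗ R.ofV c = k • LinearMap.id := LinearMap.ext hk
  have hfinrank : (Module.finrank ℂ V : ℂ) ≠ 0 := Nat.cast_ne_zero.mpr Module.finrank_pos.ne'
  rw [hk, kappa_apply, ← trace_toV_ofV, hscalar, map_smul, LinearMap.trace_id, smul_eq_mul,
    mul_comm k, inv_mul_cancel_left₀ hfinrank]

theorem Roots.kappa_ne_zero [Nonempty (Refl G)] : R.kappa ≠ 0 := by
  intro hzero
  obtain ⟨s⟩ := ‹Nonempty (Refl G)›
  have : Nontrivial V := nontrivial_of_ne _ _ (R.coroot_ne_zero s)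
  have hone := LinearMap.congr_fun hzero (⟨fun _ => 1, fun _ _ => rfl⟩ : ClassFun G)
  rw [kappa_apply, LinearMap.zero_apply, mul_eq_zero, inv_eq_zero, Nat.cast_eq_zero] at hone
  have hre := congrArg Complex.re (hone.resolve_left Module.finrank_pos.ne')
  simp only [one_mul, Complex.re_sum, Complex.zero_re] at hre
  exact (Finset.sum_pos (fun s _ => R.re_root_coroot_pos s) ⟨s, Finset.mem_univ s⟩).ne' hre

end Kappa

end CherednikEmbedding

end

open CherednikEmbedding in
theorem mainTheorem10_general {V : Type*} [AddCommGroup V] [Module ℂ V] [FiniteDimensional ℂ V]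
    (G : Subgroup (V ≃ₗ[ℂ] V)) [Finite G] [Nonempty (Refl G)]
    (hirr : (natRep G).IsIrreducible) (R : Roots G) :
    ∃ κ : ClassFun G →ₗ[ℂ] ℂ, κ ≠ 0 ∧
      (∀ (c : ClassFun G) (v : V),
        ∑ s : Refl G, (c : Refl G → ℂ) s • (v - (s.1 : V ≃ₗ[ℂ] V) v) = κ c • v) ∧
      ∀ (t : ℂ) (c : ClassFun G), κ c ≠ 0 →
        ∃ (t' : ℂ) (Φ : Cherednik G t c →ₐ[ℂ] R.DeformedDouble t'),
          Function.Injective Φ ∧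
            ∀ x : Gens G V, Φ (cherednikι G t c x) = R.deformedι t' (R.M c x) := by
  have hκ := R.toV_ofV_eq_kappa_smul hirr
  exact ⟨R.kappa, R.kappa_ne_zero, fun c v => (R.toV_ofV c v).symm.trans (hκ c v), fun t c hc =>
    ⟨t / R.kappa c, R.exists_injective_algHom (hκ c) hc (div_mul_cancel₀ t hc).symm⟩⟩

open CherednikEmbedding in
theorem mainTheorem10 {V : Type*} [AddCommGroup V] [Module ℂ V] [FiniteDimensional ℂ V]
    (G : Subgroup (V ≃ₗ[ℂ] V)) [Finite G] [Nontrivial G]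
    (hirr : (natRep G).IsIrreducible)
    (hgen : Subgroup.closure {s : G | IsComplexReflection (s : V ≃ₗ[ℂ] V)} = ⊤)
    (R : Roots G) :
    ∃ κ : ClassFun G →ₗ[ℂ] ℂ, κ ≠ 0 ∧
      (∀ (c : ClassFun G) (v : V),
        ∑ s : Refl G, (c : Refl G → ℂ) s • (v - (s.1 : V ≃ₗ[ℂ] V) v) = κ c • v) ∧
      ∀ (t : ℂ) (c : ClassFun G), t ≠ 0 → κ c ≠ 0 →
        ∃ (t' : ℂ) (Φ : Cherednik G t c →ₐ[ℂ] R.DeformedDouble t'),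
          Function.Injective Φ ∧
            ∀ x : Gens G V, Φ (cherednikι G t c x) = R.deformedι t' (R.M c x) := by
  have := nonempty_refl_of_closure_eq_top hgen
  obtain ⟨κ, hκ, hscalar, hembed⟩ := mainTheorem10_general G hirr R
  exact ⟨κ, hκ, hscalar, fun t c _ => hembed t c⟩
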